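/- Setting. A synchronous system consists of a finite set $\mathcal V$ of agents joined by a directed graph $G(\mathcal V,\mathcal E)$ without self-loops; $N_i^-=\{j:(j,i)\in\mathcal E\}$ and $d_i^-=|N_i^-|$. Let $f\ge 0$ be an integer. For a set $\mathcal F\subseteq\mathcal V$, a reduced graph is a graph on $\mathcal V\setminus\mathcal F$ obtained from $G$ by deleting $\mathcal F$ with all its edges and then at most $f$ further incoming edges at each remaining agent. Assume that for every $\mathcal F\subseteq\mathcal V$ with $|\mathcal F|\le f$, every reduced graph contains an agent that has a directed path to every other agent of the reduced graph. Fix the set $\mathcal F$ of (Byzantine) faulty agents, $|\mathcal F|\le f$, and put $\mathcal N=\mathcal V\setminus\mathcal F$ and $\phi_i=|N_i^-\cap\mathcal F|$. Let $\mathcal X\subseteq\mathbb R$ be nonempty, closed and convex, with projection $P_{\mathcal X}$, and let $L$ be a constant. Each agent $i$ has an admissible cost function $h_i:\mathcal X\to\mathbb R$: it is convex and continuously differentiable (one-sidedly at end points of $\mathcal X$), $h_i'$ is $L$-Lipschitz, $|h_i'|\le L$ on $\mathcal X$, and $\arg\min_{\mathcal X}h_i$ is nonempty and compact. The stepsizes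 $\lambda[t]$, $t\ge 0$, are real with $\lambda[t+1]\le\lambda[t]$, $\sum_t\lambda[t]=\infty$ and $\sum_t\lambda[t]^2<\infty$. Algorithm 2. Initially $x_j[0]\in\mathcal X$ for each $j\in\mathcal N$. In iteration $t\ge1$, each $j\in\mathcal N$ receives from each $i\in N_j^-$ a pair $(w_i[t-1],g_i[t-1])\in\mathbb R^2$, which equals $(x_i[t-1],h_i'(x_i[t-1]))$ if $i\in\mathcal N$ and is arbitrary (it may depend on $j$ and $t$) if $i\in\mathcal F$; for $i=j$ put $w_j[t-1]=x_j[t-1]$ and $g_j[t-1]=h_j'(x_j[t-1])$. Agent $j$ sorts the values $w_i[t-1]$, $i\in N_j^-$, and erases the $f$ smallest and the $f$ largest ones (ties broken arbitrarily); $\mathcal R_j^1[t-1]$ is the set of the remaining senders. Likewise it erases the $f$ smallest and the $f$ largest of the values $g_i[t-1]$, $i\in N_j^-\cup\{j\}$; let $\hat g_j[t-1]$ and $\check g_j[t-1]$ be the largest and smallest remaining values, and $\widetilde g_j[t-1]=\frac12(\hat g_j[t-1]+\check g_j[t-1])$. Then $$x_j[t]=P_{\mathcal X}\Big[\frac1{d_j^-+1-2f}\sum_{i\in\mathcal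 R_j^1[t-1]\cup\{j\}}w_i[t-1]-\lambda[t-1]\,\widetilde g_j[t-1]\Big].$$ For reals $\beta,\gamma$ let $\mathcal A(\beta,\gamma)$ be the set of functions $p=\sum_{i\in\mathcal N}\alpha_ih_i$ with $\alpha_i\ge0$, $\sum_{i\in\mathcal N}\alpha_i=1$ and $|\{i\in\mathcal N:\alpha_i\ge\beta\}|\ge\gamma$, and let $Y(\beta,\gamma)=\bigcup_{p\in\mathcal A(\beta,\gamma)}\arg\min_{x\in\mathcal X}p(x)$. Theorem. Let $$\tilde\beta=\min\Big\{\frac1{2\max_{i\in\mathcal N}(d_i^-+1-\phi_i-f)},\ \frac1{|\mathcal N|}\Big\},\qquad \tilde\gamma=\min_{i\in\mathcal N}(d_i^-+1-\phi_i-f),$$ and $Y=Y(\tilde\beta,\tilde\gamma)$. For each $t\ge0$ let $z[t]=x_{j_t}[t]$, where $j_t\in\arg\max_{j\in\mathcal N}\mathrm{Dist}(x_j[t],Y)$ and $\mathrm{Dist}(x,Y)=\inf_{y\in Y}|x-y|$. Then, for every execution of Algorithm 2 with faulty set $\mathcal F$, $Y$ is nonempty, the sequence $\mathrm{Dist}(z[t],Y)$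 converges, and $\lim_{t\to\infty}\mathrm{Dist}(z[t],Y)=0$. -/

import Mathlib

open Filter Topology

namespace ByzantineOpt

/-! Directed networks, reduced graphs and source components. -/

section Network

variable {V : Type*} [Fintype V] [DecidableEq V]

open Classical in
/-- The incoming neighbours `N_i⁻` of agent `i`: all `j` with a directed edge from `j` to `i`. -/
noncomputable def inNbrs (G : Digraph V) (i : V) : Finset V :=
  Finset.univ.filter fun j => G.Adj j i

/-- The incoming degree `d_i⁻`. -/
noncomputable def inDeg (G : Digraph V) (i : V) : ℕ := (inNbrs G i).card

open Classical in
/-- `H` is a reduced graph of `G` for the faulty set `F`: a graph on the agents outside `F`,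
obtained from `G` by removing the faulty agents with all their edges and then at most `f` further
incoming edges at each non-faulty agent. (As a relation on `V`, `H` has no edge at an agent of
`F`; its vertex set is `V \ F`.) -/
def IsReducedGraph (G : Digraph V) (F : Finset V) (f : ℕ) (H : Digraph V) : Prop :=
  (∀ u v, H.Adj u v → G.Adj u v ∧ u ∉ F ∧ v ∉ F) ∧
  ∀ i, i ∉ F → ((inNbrs G i).filter fun j => j ∉ F ∧ ¬ H.Adj j i).card ≤ f

/-- The source component of a graph `H` with vertex set `V \ F`: the agents that have a directed
path to every other agent. -/
def sourceComponent (F : Finset V) (H : Digraph V) : Set V :=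
  {i | i ∉ F ∧ ∀ j, j ∉ F → Relation.ReflTransGen H.Adj i j}

/-- For every set of at most `f` agents that could be faulty, every reduced graph contains a
(nonempty) source component. -/
def EveryReducedGraphHasSource (G : Digraph V) (f : ℕ) : Prop :=
  ∀ F : Finset V, F.card ≤ f →
    ∀ H : Digraph V, IsReducedGraph G F f H → (sourceComponent F H).Nonempty

/-- Under the graph condition there is a non-faulty agent. -/
theorem EveryReducedGraphHasSource.nonempty {G : Digraph V} {f : ℕ}
    (hG : EveryReducedGraphHasSource G f) {F : Finset V} (hF : F.card ≤ f) : Fᶜ.Nonempty := by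
  classical
  have hred : IsReducedGraph G F f ⟨fun u v => G.Adj u v ∧ u ∉ F ∧ v ∉ F⟩ := by
    refine ⟨fun u v h => h, fun i hi => ?_⟩
    refine (Finset.card_eq_zero.2 (Finset.eq_empty_of_forall_notMem fun j hj => ?_)).trans_le
      (Nat.zero_le f)
    simp only [inNbrs, Finset.mem_filter, Finset.mem_univ, true_and] at hj
    tauto
  obtain ⟨i, hi, -⟩ := hG F hF _ hred
  exact ⟨i, by simpa using hi⟩

/-- The number `d_i⁻ + 1 - φ_i - f`, where `φ_i` counts the faulty incoming neighbours of `i`. -/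
noncomputable def slack (G : Digraph V) (F : Finset V) (f : ℕ) (i : V) : ℝ :=
  (inDeg G i : ℝ) + 1 - ((inNbrs G i ∩ F).card : ℝ) - (f : ℝ)

/-- `β̃ = min {1 / (2 max_{i ∈ N} (d_i⁻ + 1 - φ_i - f)), 1 / |N|}`, where `N = V \ F`. -/
noncomputable def betaTilde (G : Digraph V) (F : Finset V) (f : ℕ) (hN : Fᶜ.Nonempty) : ℝ :=
  min (1 / (2 * Fᶜ.sup' hN (slack G F f))) (1 / (Fᶜ.card : ℝ))

/-- `γ̃ = min_{i ∈ N} (d_i⁻ + 1 - φ_i - f)`, where `N = V \ F`. -/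
noncomputable def gammaTilde (G : Digraph V) (F : Finset V) (f : ℕ) (hN : Fᶜ.Nonempty) : ℝ :=
  Fᶜ.inf' hN (slack G F f)

end Network

/-! Cost functions, valid functions and the set of their constrained optima. -/

/-- The minimizers of `p` over `X`. -/
def argminOn (p : ℝ → ℝ) (X : Set ℝ) : Set ℝ := {x | x ∈ X ∧ IsMinOn p X x}

/-- `h` is an admissible cost function on `X` with constant `L`. Only the values of `h` on `X`
matter; the gradient is the derivative within `X` (one-sided at an end point of `X`). -/
structure Admissible (X : Set ℝ) (L : ℝ) (h : ℝ → ℝ) : Prop where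
  convex : ConvexOn ℝ X h
  contDiff : ContDiffOn ℝ 1 h X
  lipschitz_grad : ∀ x ∈ X, ∀ y ∈ X, |derivWithin h X x - derivWithin h X y| ≤ L * |x - y|
  bounded_grad : ∀ x ∈ X, |derivWithin h X x| ≤ L
  argmin_nonempty : (argminOn h X).Nonempty
  argmin_compact : IsCompact (argminOn h X)

section Valid

variable {V : Type*} [Fintype V] [DecidableEq V]

open Classical in
/-- The collection `A(β, γ)` of valid functions: convex combinations of the cost functions of the
agents outside `F`, at least `γ` of which have a weight that is at least `β`. -/
def validFunctions (F : Finset V) (h : V → ℝ → ℝ) (β γ : ℝ) : Set (ℝ → ℝ) :=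
  {p | ∃ α : V → ℝ, (∀ i ∈ Fᶜ, 0 ≤ α i) ∧ ∑ i ∈ Fᶜ, α i = 1 ∧
    γ ≤ ((Fᶜ.filter fun i => β ≤ α i).card : ℝ) ∧ p = fun x => ∑ i ∈ Fᶜ, α i * h i x}

/-- `Y(β, γ)`: the minimizers over `X` of the valid functions. -/
def optSet (X : Set ℝ) (F : Finset V) (h : V → ℝ → ℝ) (β γ : ℝ) : Set ℝ :=
  ⋃ p ∈ validFunctions F h β γ, argminOn p X

end Valid

/-! The algorithm. -/

/-- `y` is the projection of `u` on `X`. -/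
def IsProjection (X : Set ℝ) (u y : ℝ) : Prop := y ∈ X ∧ ∀ z ∈ X, |y - u| ≤ |z - u|

section Algorithm

variable {V : Type*} [Fintype V] [DecidableEq V]

/-- `R` is what remains of the set `A` of identifiers when the values `v i`, `i ∈ A`, are sorted
(ties broken arbitrarily) and the `f` smallest (from `S`) and the `f` largest ones (from `T`) are
erased. -/
def IsTrimmed (A : Finset V) (v : V → ℝ) (f : ℕ) (R : Finset V) : Prop :=
  ∃ S T : Finset V, S ⊆ A ∧ T ⊆ A ∧ Disjoint S T ∧ S.card = f ∧ T.card = f ∧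
    (∀ s ∈ S, ∀ k ∈ A \ S, v s ≤ v k) ∧ (∀ l ∈ T, ∀ k ∈ A \ T, v k ≤ v l) ∧
    R = A \ (S ∪ T)

/-- One iteration of Algorithm 2 at agent `j`, for the previous estimates `x` and the stepsize
`lam`, resulting in the new estimate `y`. Here `(w i, g i)` is the tuple that `j` receives from
`i` (for `i = j`, its own estimate and gradient). What a faulty neighbour `i ∈ F` sends to `j`, or
the default tuple if nothing is sent, is arbitrary. -/
def AlgorithmStep (G : Digraph V) (F : Finset V) (f : ℕ) (X : Set ℝ) (h : V → ℝ → ℝ)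
    (lam : ℝ) (x : V → ℝ) (j : V) (y : ℝ) : Prop :=
  ∃ w g : V → ℝ,
    (∀ i ∈ insert j (inNbrs G j), i ∉ F → w i = x i ∧ g i = derivWithin (h i) X (x i)) ∧
    ∃ R₁ R₂ : Finset V,
      IsTrimmed (inNbrs G j) w f R₁ ∧
      IsTrimmed (insert j (inNbrs G j)) g f R₂ ∧
      ∃ gmax gmin : ℝ,
        IsGreatest (g '' (R₂ : Set V)) gmax ∧ IsLeast (g '' (R₂ : Set V)) gmin ∧
        IsProjection X
          (1 / ((inDeg G j : ℝ) + 1 - 2 * (f : ℝ)) * (∑ i ∈ insert j R₁, w i)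
            - lam * ((gmax + gmin) / 2)) y

/-- `x t j` is the estimate of agent `j` after `t` iterations of an execution of Algorithm 2 with
faulty set `F`. The values at the faulty agents are irrelevant. -/
def IsExecution (G : Digraph V) (F : Finset V) (f : ℕ) (X : Set ℝ) (h : V → ℝ → ℝ)
    (lam : ℕ → ℝ) (x : ℕ → V → ℝ) : Prop :=
  (∀ j, j ∉ F → x 0 j ∈ X) ∧
  ∀ t, ∀ j, j ∉ F → AlgorithmStep G F f X h (lam t) (x t) j (x (t + 1) j)

end Algorithm

/-- The stepsizes are non-increasing, not summable, and square-summable. -/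
structure IsStepsize (lam : ℕ → ℝ) : Prop where
  antitone : Antitone lam
  sum_infinite : Tendsto (fun n => ∑ t ∈ Finset.range n, lam t) atTop atTop
  sum_sq_finite : Summable fun t => lam t ^ 2

end ByzantineOpt

/-!
More than `f` agents with low values pull a low value into the trimmed mean of a common neighbour.
If neither of two disjoint sets of agents has a member with more than `f` non-faulty incoming
neighbours outside its set, then cutting all edges into both sets yields a reduced graph whose
source lies in both, a contradiction. Applied to the agents near the top and those near the bottom,
this says that within `|N|` iterations one of the two groups disappears, so that the diameter of the
estimates contracts up to the size of the gradient steps, and tends to `0`.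

The midpoint of the trimmed gradients is a convex combination of the non-faulty gradients with valid
weights: every non-faulty gradient, apart from at most `f` exceptions, can carry at least half of
the weight in such a combination, and one averages over them. At a point above `Y` the valid
gradients are all positive, and uniformly so because the valid weights are compact. Since the steps
are not summable, they push the estimates, which are nearly equal, down to `Y`; reflection deals
with the other side. Finally `Y` is an interval: at a point outside it no valid gradient vanishes,
hence they all have the same sign because the valid weights are star-shaped about the uniform ones.
-/

namespace ByzantineOpt

section Weights

variable {V : Type*} [Fintype V] {N : Finset V} {α : V → ℝ} {β γ : ℝ}

/-- The weights on `V` that are nonnegative, sum to `1` and vanish off `N`. A convex combination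
over `N` of the values `d` is the dot product of such weights with `d`. -/
def simplexOn (N : Finset V) : Set (V → ℝ) := {α | α ∈ stdSimplex ℝ V ∧ ∀ i ∉ N, α i = 0}

theorem convex_simplexOn (N : Finset V) : Convex ℝ (simplexOn N) :=
  (convex_stdSimplex ℝ V).inter fun α hα α' hα' a b _ _ _ i hi => by
    simp [hα i hi, hα' i hi]

theorem isCompact_simplexOn (N : Finset V) : IsCompact (simplexOn N) := by
  have hclosed : IsClosed {α : V → ℝ | ∀ i ∉ N, α i = 0} := by
    simp only [Set.ofPred_forall]
    exact isClosed_iInter fun i => isClosed_iInter fun _ =>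
      isClosed_eq (continuous_apply i) continuous_const
  exact (isCompact_stdSimplex ℝ V).inter_right hclosed

theorem simplexOn_mono {M N : Finset V} (hMN : M ⊆ N) : simplexOn M ⊆ simplexOn N :=
  fun _ hα => ⟨hα.1, fun i hi => hα.2 i fun hM => hi (hMN hM)⟩

theorem single_mem_simplexOn [DecidableEq V] {i : V} (hi : i ∈ N) :
    Pi.single i (1 : ℝ) ∈ simplexOn N :=
  ⟨single_mem_stdSimplex ℝ i, fun _ hk => Pi.single_eq_of_ne (ne_of_mem_of_not_mem hi hk).symm 1⟩

theorem centroidWeightsIndicator_mem_simplexOn (hN : N.Nonempty) :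
    N.centroidWeightsIndicator ℝ ∈ simplexOn N :=
  ⟨⟨fun _ => Set.indicator_nonneg (fun _ _ => by simp) _,
    N.sum_centroidWeightsIndicator_eq_one_of_nonempty ℝ hN⟩,
    fun _ hi => Set.indicator_of_notMem (by simpa using hi) _⟩

theorem nonempty_of_mem_simplexOn (hα : α ∈ simplexOn N) : N.Nonempty := by
  by_contra! hN
  have hsum : ∑ i, α i = 0 := Finset.sum_eq_zero fun i _ => hα.2 i (hN ▸ Finset.notMem_empty i)
  exact one_ne_zero (hα.1.2.symm.trans hsum)

theorem dotProduct_eq_sum_of_mem_simplexOn (hα : α ∈ simplexOn N) (d : V → ℝ) :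
    α ⬝ᵥ d = ∑ i ∈ N, α i * d i :=
  (Finset.sum_subset N.subset_univ fun i _ hi => by rw [hα.2 i hi, zero_mul]).symm

theorem dotProduct_le_dotProduct_of_mem_simplexOn (hα : α ∈ simplexOn N) {a b : V → ℝ}
    (hab : ∀ i ∈ N, a i ≤ b i) : α ⬝ᵥ a ≤ α ⬝ᵥ b := by
  simp only [dotProduct_eq_sum_of_mem_simplexOn hα]
  exact Finset.sum_le_sum fun i hi => mul_le_mul_of_nonneg_left (hab i hi) (hα.1.1 i)

theorem dotProduct_const_of_mem_simplexOn (hα : α ∈ simplexOn N) (c : ℝ) :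
    (α ⬝ᵥ fun _ => c) = c := by
  rw [dotProduct, ← Finset.sum_mul, hα.1.2, one_mul]

theorem abs_dotProduct_le_of_mem_simplexOn (hα : α ∈ simplexOn N) {d : V → ℝ} {L : ℝ}
    (hd : ∀ i ∈ N, |d i| ≤ L) : |α ⬝ᵥ d| ≤ L := by
  have hlower := dotProduct_le_dotProduct_of_mem_simplexOn hα fun i hi => (abs_le.1 (hd i hi)).1
  have hupper := dotProduct_le_dotProduct_of_mem_simplexOn hα fun i hi => (abs_le.1 (hd i hi)).2
  rw [dotProduct_const_of_mem_simplexOn hα] at hlower hupper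
  exact abs_le.2 ⟨hlower, hupper⟩

/-- The weights of the valid functions in `A(β, γ)`, for the set `N` of non-faulty agents. They are
normalized to vanish off `N`, which makes them a compact set. -/
def validWeights (N : Finset V) (β γ : ℝ) : Set (V → ℝ) :=
  {α ∈ simplexOn N | γ ≤ ((N.filter fun i => β ≤ α i).card : ℝ)}

theorem isCompact_validWeights (N : Finset V) (β γ : ℝ) : IsCompact (validWeights N β γ) := by
  have hunion : {α : V → ℝ | γ ≤ ((N.filter fun i => β ≤ α i).card : ℝ)} =
      ⋃ I ∈ {I : Finset V | I ⊆ N ∧ γ ≤ (I.card : ℝ)}, ⋂ i ∈ I, {α : V → ℝ | β ≤ α i} := by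
    ext α
    simp only [Set.mem_ofPred_eq, Set.mem_iUnion, Set.mem_iInter, exists_prop]
    refine ⟨fun hγ => ⟨_, ⟨Finset.filter_subset _ _, hγ⟩, fun i hi => (Finset.mem_filter.1 hi).2⟩,
      ?_⟩
    rintro ⟨I, ⟨hIN, hγ⟩, hle⟩
    exact hγ.trans (Nat.cast_le.2 (Finset.card_le_card fun i hi =>
      Finset.mem_filter.2 ⟨hIN hi, hle i hi⟩))
  have hclosed : IsClosed {α : V → ℝ | γ ≤ ((N.filter fun i => β ≤ α i).card : ℝ)} := by
    rw [hunion]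
    exact (Set.toFinite _).isClosed_biUnion fun I _ => isClosed_biInter fun i _ =>
      isClosed_le continuous_const (continuous_apply i)
  exact (isCompact_simplexOn N).inter_right hclosed

omit [Fintype V] in
theorem le_centroidWeightsIndicator (hβ : β ≤ 1 / (N.card : ℝ)) {i : V} (hi : i ∈ N) :
    β ≤ N.centroidWeightsIndicator ℝ i := by
  simpa [Finset.centroidWeightsIndicator_def, Set.indicator_of_mem (Finset.mem_coe.2 hi)] using hβ

theorem centroidWeightsIndicator_mem_validWeights (hN : N.Nonempty) (hβ : β ≤ 1 / (N.card : ℝ))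
    (hγ : γ ≤ (N.card : ℝ)) : N.centroidWeightsIndicator ℝ ∈ validWeights N β γ :=
  ⟨centroidWeightsIndicator_mem_simplexOn hN, by
    rwa [Finset.filter_true_of_mem fun i hi => le_centroidWeightsIndicator hβ hi]⟩

theorem starConvex_validWeights (hβ : β ≤ 1 / (N.card : ℝ)) :
    StarConvex ℝ (N.centroidWeightsIndicator ℝ) (validWeights N β γ) := by
  intro α hα a b ha hb hab
  refine ⟨convex_simplexOn N
    (centroidWeightsIndicator_mem_simplexOn (nonempty_of_mem_simplexOn hα.1)) hα.1 ha hb hab,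
    hα.2.trans (Nat.cast_le.2 (Finset.card_le_card fun i hi => ?_))⟩
  obtain ⟨hiN, hi⟩ := Finset.mem_filter.1 hi
  exact Finset.mem_filter.2
    ⟨hiN, convex_Ici β (le_centroidWeightsIndicator hβ hiN) hi ha hb hab⟩

theorem exists_pos_forall_le_dotProduct_of_isCompact {W : Set (V → ℝ)} (hW : IsCompact W)
    {d : V → ℝ} (hd : ∀ α ∈ W, 0 < α ⬝ᵥ d) : ∃ δ > 0, ∀ α ∈ W, δ ≤ α ⬝ᵥ d :=
  hW.exists_forall_le' (by fun_prop) hd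

end Weights

section Subgradients

variable {X : Set ℝ} {p d : ℝ → ℝ} {x z : ℝ}

/-- `d` assigns to each point of `X` a subgradient of the restriction of `p` to `X`. -/
def IsSubgradientOn (X : Set ℝ) (p d : ℝ → ℝ) : Prop :=
  ∀ x ∈ X, ∀ y ∈ X, p x + d x * (y - x) ≤ p y

theorem isSubgradientOn_derivWithin (hp : ConvexOn ℝ X p) (hd : DifferentiableOn ℝ p X) :
    IsSubgradientOn X p (derivWithin p X) := by
  intro x hx y hy
  rcases lt_trichotomy x y with hxy | rfl | hyx
  · have hslope := hp.derivWithin_le_slope hx hy hxy (hd x hx)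
    rw [slope_def_field, le_div_iff₀ (sub_pos.2 hxy)] at hslope
    linarith
  · simp
  · have hslope := hp.slope_le_derivWithin hy hx hyx (hd x hx)
    rw [slope_def_field, div_le_iff₀ (sub_pos.2 hyx)] at hslope
    linarith

theorem IsSubgradientOn.dotProduct {V : Type*} [Fintype V] {N : Finset V} {α : V → ℝ}
    {p d : V → ℝ → ℝ} (hd : ∀ i ∈ N, IsSubgradientOn X (p i) (d i)) (hα : α ∈ simplexOn N) :
    IsSubgradientOn X (fun x => α ⬝ᵥ fun i => p i x) (fun x => α ⬝ᵥ fun i => d i x) := by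
  intro x hx y hy
  calc (α ⬝ᵥ fun i => p i x) + (α ⬝ᵥ fun i => d i x) * (y - x)
      = α ⬝ᵥ fun i => p i x + d i x * (y - x) := by
        simp only [_root_.dotProduct, Finset.sum_mul, ← Finset.sum_add_distrib]
        exact Finset.sum_congr rfl fun i _ => by ring
    _ ≤ α ⬝ᵥ fun i => p i y :=
        dotProduct_le_dotProduct_of_mem_simplexOn hα fun i hi => hd i hi x hx y hy

theorem IsSubgradientOn.mem_argminOn (hd : IsSubgradientOn X p d) (hz : z ∈ argminOn p X)
    (hx : x ∈ X) (hdx : d x * (x - z) ≤ 0) : x ∈ argminOn p X := by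
  refine ⟨hx, fun y hy => ?_⟩
  have hxz : p x + d x * (z - x) ≤ p z := hd x hx z hz.1
  have hzy : p z ≤ p y := hz.2 hy
  change p x ≤ p y
  linarith

end Subgradients

section OptimalSet

/-- A differentiable convex function on `X` that attains its minimum there. -/
structure IsConvexCost (X : Set ℝ) (h : ℝ → ℝ) : Prop where
  convex : ConvexOn ℝ X h
  differentiableOn : DifferentiableOn ℝ h X
  argmin_nonempty : (argminOn h X).Nonempty

theorem Admissible.isConvexCost {X : Set ℝ} {L : ℝ} {h : ℝ → ℝ} (hh : Admissible X L h) :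
    IsConvexCost X h :=
  ⟨hh.convex, hh.contDiff.differentiableOn one_ne_zero, hh.argmin_nonempty⟩

variable {V : Type*} [Fintype V] {X : Set ℝ} {h : V → ℝ → ℝ}

-- Clamping a point to the interval spanned by the individual minimizers moves it towards each of
-- them, which does not increase any of the convex functions.
theorem argminOn_dotProduct_nonempty {N : Finset V} (hh : ∀ i ∈ N, IsConvexCost X (h i))
    {α : V → ℝ} (hα : α ∈ simplexOn N) : (argminOn (fun y => α ⬝ᵥ fun i => h i y) X).Nonempty := by
  have hN := nonempty_of_mem_simplexOn hα
  choose! c hc using fun i hi => (hh i hi).argmin_nonempty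
  obtain ⟨a, haN, ha⟩ := N.exists_min_image c hN
  obtain ⟨b, hbN, hb⟩ := N.exists_max_image c hN
  have hsub : Set.Icc (c a) (c b) ⊆ X :=
    (hh a haN).convex.1.ordConnected.out (hc a haN).1 (hc b hbN).1
  have hcont : ContinuousOn (fun y => ∑ i ∈ N, α i * h i y) (Set.Icc (c a) (c b)) :=
    continuousOn_finsetSum _ fun i hi =>
      continuousOn_const.mul ((hh i hi).differentiableOn.continuousOn.mono hsub)
  obtain ⟨z, hz, hzmin⟩ := isCompact_Icc.exists_isMinOn ⟨c a, le_rfl, ha b hbN⟩ hcont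
  refine ⟨z, hsub hz, fun y hy => ?_⟩
  set y' := max (c a) (min y (c b))
  have hy'mem : y' ∈ Set.Icc (c a) (c b) := ⟨le_max_left _ _, max_le (ha b hbN) (min_le_right _ _)⟩
  have hclamp : ∀ i ∈ N, h i y' ≤ h i y := fun i hi => by
    have hseg : y' ∈ segment ℝ (c i) y := by
      have := ha i hi
      have := hb i hi
      rw [segment_eq_uIcc, Set.mem_uIcc]
      grind
    exact ((hh i hi).convex.le_max_of_mem_segment (hc i hi).1 hy hseg).trans
      (max_le ((hc i hi).2 hy) le_rfl)
  calc (α ⬝ᵥ fun i => h i z) = ∑ i ∈ N, α i * h i z := dotProduct_eq_sum_of_mem_simplexOn hα _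
    _ ≤ ∑ i ∈ N, α i * h i y' := hzmin hy'mem
    _ = α ⬝ᵥ fun i => h i y' := (dotProduct_eq_sum_of_mem_simplexOn hα _).symm
    _ ≤ α ⬝ᵥ fun i => h i y := dotProduct_le_dotProduct_of_mem_simplexOn hα hclamp

variable [DecidableEq V] {F : Finset V} {β γ x : ℝ}

theorem mem_optSet_iff : x ∈ optSet X F h β γ ↔
    ∃ α ∈ validWeights Fᶜ β γ, x ∈ argminOn (fun y => α ⬝ᵥ fun i => h i y) X := by
  simp only [optSet, validFunctions, Set.mem_iUnion, Set.mem_ofPred_eq, exists_prop]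
  constructor
  · rintro ⟨_, ⟨α, hα0, hα1, hγ, rfl⟩, hx⟩
    set α' : V → ℝ := fun i => if i ∈ Fᶜ then α i else 0
    have hα' : ∀ i ∈ Fᶜ, α' i = α i := fun i hi => if_pos hi
    have hsum : ∀ d : V → ℝ, ∑ i ∈ Fᶜ, α i * d i = α' ⬝ᵥ d := fun d => by
      simp only [dotProduct, α', ite_mul, zero_mul, Finset.sum_ite_mem, Finset.univ_inter]
    refine ⟨α', ⟨⟨⟨fun i => ?_, ?_⟩, fun i hi => if_neg hi⟩, ?_⟩, by simpa only [hsum] using hx⟩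
    · by_cases hi : i ∈ Fᶜ
      · exact (hα0 i hi).trans_eq (hα' i hi).symm
      · exact (if_neg hi).ge
    · simpa [dotProduct, hα1] using (hsum fun _ => 1).symm
    · refine hγ.trans_eq (congrArg _ (congrArg _ (Finset.filter_congr fun i hi => ?_)))
      rw [hα' i hi]
  · rintro ⟨α, ⟨hα, hγ⟩, hx⟩
    have hsum := dotProduct_eq_sum_of_mem_simplexOn hα
    refine ⟨_, ⟨α, fun i _ => hα.1.1 i, ?_, hγ, rfl⟩, by simpa only [hsum] using hx⟩
    simpa only [hsum, mul_one] using dotProduct_const_of_mem_simplexOn hα 1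

theorem optSet_subset : optSet X F h β γ ⊆ X := fun _ hx => by
  obtain ⟨_, _, hx⟩ := mem_optSet_iff.1 hx
  exact hx.1

variable (hh : ∀ i ∉ F, IsConvexCost X (h i))
include hh

theorem optSet_nonempty (hβ : β ≤ 1 / (Fᶜ.card : ℝ)) (hγ : γ ≤ (Fᶜ.card : ℝ)) (hF : Fᶜ.Nonempty) :
    (optSet X F h β γ).Nonempty := by
  have hα := centroidWeightsIndicator_mem_validWeights hF hβ hγ
  obtain ⟨z, hz⟩ := argminOn_dotProduct_nonempty (fun i hi => hh i (Finset.mem_compl.1 hi)) hα.1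
  exact ⟨z, mem_optSet_iff.2 ⟨_, hα, hz⟩⟩

theorem dotProduct_derivWithin_mul_sub_pos {α : V → ℝ} (hα : α ∈ validWeights Fᶜ β γ)
    (hx : x ∈ X) (hxY : x ∉ optSet X F h β γ) {z : ℝ}
    (hz : z ∈ argminOn (fun y => α ⬝ᵥ fun i => h i y) X) :
    0 < (α ⬝ᵥ fun i => derivWithin (h i) X x) * (x - z) := by
  have hsub := IsSubgradientOn.dotProduct (fun i hi => isSubgradientOn_derivWithin
    (hh i (Finset.mem_compl.1 hi)).convex (hh i (Finset.mem_compl.1 hi)).differentiableOn) hα.1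
  by_contra! hle
  exact hxY (mem_optSet_iff.2 ⟨α, hα, hsub.mem_argminOn hz hx hle⟩)

theorem exists_mem_optSet_dotProduct_mul_sub_pos {α : V → ℝ} (hα : α ∈ validWeights Fᶜ β γ)
    (hx : x ∈ X) (hxY : x ∉ optSet X F h β γ) :
    ∃ z ∈ optSet X F h β γ, 0 < (α ⬝ᵥ fun i => derivWithin (h i) X x) * (x - z) := by
  obtain ⟨z, hz⟩ := argminOn_dotProduct_nonempty (fun i hi => hh i (Finset.mem_compl.1 hi)) hα.1
  exact ⟨z, mem_optSet_iff.2 ⟨α, hα, hz⟩, dotProduct_derivWithin_mul_sub_pos hh hα hx hxY hz⟩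

theorem optSet_ordConnected (hX : X.OrdConnected) (hβ : β ≤ 1 / (Fᶜ.card : ℝ)) :
    (optSet X F h β γ).OrdConnected := by
  refine ⟨fun y₁ hy₁ y₂ hy₂ x hx => ?_⟩
  by_contra hxY
  have hxX : x ∈ X := hX.out (optSet_subset hy₁) (optSet_subset hy₂) hx
  set d : V → ℝ := fun i => derivWithin (h i) X x
  obtain ⟨α₁, hα₁, hz₁⟩ := mem_optSet_iff.1 hy₁
  obtain ⟨α₂, hα₂, hz₂⟩ := mem_optSet_iff.1 hy₂
  have hd₁ : 0 < α₁ ⬝ᵥ d := pos_of_mul_pos_left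
    (dotProduct_derivWithin_mul_sub_pos hh hα₁ hxX hxY hz₁) (sub_nonneg.2 hx.1)
  have hd₂ : α₂ ⬝ᵥ d < 0 := neg_of_mul_pos_left
    (dotProduct_derivWithin_mul_sub_pos hh hα₂ hxX hxY hz₂) (sub_nonpos.2 hx.2)
  have hstar := starConvex_validWeights (γ := γ) hβ
  have hconn := (hstar.isPathConnected (hstar.mem ⟨α₁, hα₁⟩)).isConnected
  obtain ⟨α, hα, hαd⟩ := hconn.isPreconnected.intermediate_value hα₂ hα₁
    (f := fun α => α ⬝ᵥ d) (by fun_prop) ⟨hd₂.le, hd₁.le⟩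
  obtain ⟨z, -, hz⟩ := exists_mem_optSet_dotProduct_mul_sub_pos hh hα hxX hxY
  rw [show α ⬝ᵥ d = 0 from hαd, zero_mul] at hz
  exact hz.false

theorem exists_pos_forall_le_dotProduct_derivWithin (hx : x ∈ X)
    (hxY : ∀ y ∈ optSet X F h β γ, y < x) :
    ∃ δ > 0, ∀ α ∈ validWeights Fᶜ β γ, δ ≤ α ⬝ᵥ fun i => derivWithin (h i) X x := by
  refine exists_pos_forall_le_dotProduct_of_isCompact (isCompact_validWeights _ _ _) fun α hα => ?_
  obtain ⟨z, hz, hpos⟩ :=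
    exists_mem_optSet_dotProduct_mul_sub_pos hh hα hx fun hxY' => (hxY x hxY').false
  exact pos_of_mul_pos_left hpos (sub_nonneg.2 (hxY z hz).le)

theorem exists_pos_forall_le_dotProduct_neg_derivWithin (hx : x ∈ X)
    (hxY : ∀ y ∈ optSet X F h β γ, x < y) :
    ∃ δ > 0, ∀ α ∈ validWeights Fᶜ β γ, δ ≤ α ⬝ᵥ fun i => -derivWithin (h i) X x := by
  refine exists_pos_forall_le_dotProduct_of_isCompact (isCompact_validWeights _ _ _) fun α hα => ?_
  obtain ⟨z, hz, hpos⟩ :=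
    exists_mem_optSet_dotProduct_mul_sub_pos hh hα hx fun hxY' => (hxY x hxY').false
  have hneg := neg_of_mul_pos_left hpos (sub_nonpos.2 (hxY z hz).le)
  exact (neg_pos.2 hneg).trans_eq (dotProduct_neg _ _).symm

end OptimalSet

section Projection

variable {X : Set ℝ} {u y v : ℝ}

theorem IsProjection.neg (hy : IsProjection X u y) : IsProjection (-X) (-u) (-y) :=
  ⟨Set.neg_mem_neg.2 hy.1, fun z hz => by
    rw [← abs_neg (-y - -u), ← abs_neg (z - -u)]
    simpa [sub_eq_add_neg, add_comm] using hy.2 (-z) hz⟩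

theorem IsProjection.le_max (hX : X.OrdConnected) (hy : IsProjection X u y) (hv : v ∈ X) :
    y ≤ max u v := by
  by_contra! hlt
  have hmem : max u v ∈ X := hX.out hv hy.1 ⟨le_max_right _ _, hlt.le⟩
  have hdist := hy.2 _ hmem
  have hu := le_max_left u v
  rw [abs_of_nonneg (by linarith), abs_of_nonneg (by linarith)] at hdist
  linarith

end Projection

section Balanced

variable {V : Type*} [Fintype V] {B Q : Finset V} {g : V → ℝ} {c : ℝ} {q u : V}

/-- The number `c` is a convex combination of the values `g i`, `i ∈ B`, in which `q` has at least
half of the weight. -/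
def IsBalanced (B : Finset V) (g : V → ℝ) (c : ℝ) (q : V) : Prop :=
  ∃ α ∈ simplexOn B, α ⬝ᵥ g = c ∧ 1 / 2 ≤ α q

theorem isBalanced_of_mem_uIcc (hq : q ∈ B) (hu : u ∈ B)
    (hc : c ∈ Set.uIcc (g q) ((g q + g u) / 2)) : IsBalanced B g c q := by
  classical
  rw [← segment_eq_uIcc] at hc
  obtain ⟨s, t, hs, ht, hst, rfl⟩ := hc
  refine ⟨(s + t / 2) • Pi.single q 1 + (t / 2) • Pi.single u 1,
    convex_simplexOn B (single_mem_simplexOn hq) (single_mem_simplexOn hu) (by positivity)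
      (by positivity) (by linarith), ?_, ?_⟩
  · simp only [add_dotProduct, smul_dotProduct, single_one_dotProduct, smul_eq_mul]
    ring
  · have hsingle : 0 ≤ t / 2 * (Pi.single u 1 : V → ℝ) q :=
      mul_nonneg (by positivity) ((single_mem_stdSimplex ℝ u).1 q)
    simp only [Pi.add_apply, Pi.smul_apply, Pi.single_eq_same, smul_eq_mul]
    linarith

theorem isBalanced_or_isBalanced {s t : V} (hs : s ∈ B) (ht : t ∈ B) (hsc : g s ≤ c)
    (hct : c ≤ g t) : IsBalanced B g c s ∨ IsBalanced B g c t := by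
  rcases le_total c ((g s + g t) / 2) with hc | hc
  · exact .inl (isBalanced_of_mem_uIcc hs ht (Set.mem_uIcc_of_le hsc hc))
  · exact .inr (isBalanced_of_mem_uIcc ht hs (Set.mem_uIcc_of_ge (by linarith) hct))

theorem exists_mem_simplexOn_of_forall_isBalanced (hQ : Q.Nonempty)
    (hbal : ∀ q ∈ Q, IsBalanced B g c q) :
    ∃ α ∈ simplexOn B, α ⬝ᵥ g = c ∧ ∀ q ∈ Q, 1 / (2 * (Q.card : ℝ)) ≤ α q := by
  choose! κ hκB hκc hκq using hbal
  have hm : (0 : ℝ) < Q.card := Nat.cast_pos.2 hQ.card_pos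
  refine ⟨∑ q ∈ Q, (1 / (Q.card : ℝ)) • κ q,
    (convex_simplexOn B).sum_mem (fun _ _ => by positivity) (by simp [hm.ne']) hκB, ?_,
    fun q hq => ?_⟩
  · simp only [sum_dotProduct, smul_dotProduct, smul_eq_mul]
    rw [Finset.sum_congr rfl fun q hq => by rw [hκc q hq], Finset.sum_const, nsmul_eq_mul]
    field_simp
  · calc 1 / (2 * (Q.card : ℝ)) = 1 / (Q.card : ℝ) * (1 / 2) := by field_simp
      _ ≤ 1 / (Q.card : ℝ) * κ q q := mul_le_mul_of_nonneg_left (hκq q hq) (by positivity)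
      _ ≤ ∑ q' ∈ Q, 1 / (Q.card : ℝ) * κ q' q :=
          Finset.single_le_sum (f := fun q' => 1 / (Q.card : ℝ) * κ q' q)
            (fun q' hq' => mul_nonneg (by positivity) ((hκB q' hq').1.1 q)) hq
      _ = (∑ q' ∈ Q, (1 / (Q.card : ℝ)) • κ q') q := by simp [Finset.sum_apply]

end Balanced

section Trimming

variable {V : Type*} [DecidableEq V] {A F R : Finset V} {v : V → ℝ} {f : ℕ}

theorem IsTrimmed.neg (hR : IsTrimmed A v f R) : IsTrimmed A (-v) f R := by
  obtain ⟨S, T, hS, hT, hST, hSf, hTf, hSv, hTv, rfl⟩ := hR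
  exact ⟨T, S, hT, hS, hST.symm, hTf, hSf, fun s hs k hk => neg_le_neg (hTv s hs k hk),
    fun s hs k hk => neg_le_neg (hSv s hs k hk), by rw [Finset.union_comm]⟩

theorem IsTrimmed.subset (hR : IsTrimmed A v f R) : R ⊆ A := by
  obtain ⟨S, T, -, -, -, -, -, -, -, rfl⟩ := hR
  exact Finset.sdiff_subset

theorem IsTrimmed.card_add (hR : IsTrimmed A v f R) : R.card + 2 * f = A.card := by
  obtain ⟨S, T, hS, hT, hST, hSf, hTf, -, -, rfl⟩ := hR
  have hcard := Finset.card_sdiff_add_card_eq_card (Finset.union_subset hS hT)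
  rw [Finset.card_union_of_disjoint hST] at hcard
  omega

theorem IsTrimmed.exists_le (hR : IsTrimmed A v f R) (hF : F.card ≤ f) {r : V} (hr : r ∈ R) :
    ∃ u ∈ A \ F, v r ≤ v u := by
  obtain ⟨S, T, -, hT, -, -, hTf, -, hTv, rfl⟩ := hR
  simp only [Finset.mem_sdiff, Finset.mem_union, not_or] at hr
  have hcard : F.card < (insert r T).card := by
    rw [Finset.card_insert_of_notMem hr.2.2]
    omega
  obtain ⟨u, hu, huF⟩ := Finset.exists_mem_notMem_of_card_lt_card hcard
  rcases Finset.mem_insert.1 hu with rfl | hu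
  · exact ⟨u, Finset.mem_sdiff.2 ⟨hr.1, huF⟩, le_rfl⟩
  · exact ⟨u, Finset.mem_sdiff.2 ⟨hT hu, huF⟩, hTv u hu r (Finset.mem_sdiff.2 ⟨hr.1, hr.2.2⟩)⟩

theorem IsTrimmed.exists_ge (hR : IsTrimmed A v f R) (hF : F.card ≤ f) {r : V} (hr : r ∈ R) :
    ∃ u ∈ A \ F, v u ≤ v r := by
  obtain ⟨u, hu, hle⟩ := hR.neg.exists_le hF hr
  exact ⟨u, hu, neg_le_neg_iff.1 hle⟩

theorem IsTrimmed.exists_mem_le (hR : IsTrimmed A v f R) (hne : R.Nonempty) {D : Finset V}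
    (hDA : D ⊆ A) (hD : f < D.card) {c : ℝ} (hc : ∀ i ∈ D, v i ≤ c) : ∃ r ∈ R, v r ≤ c := by
  obtain ⟨S, T, -, -, -, hSf, -, -, hTv, rfl⟩ := hR
  obtain ⟨k, hk, hkS⟩ := Finset.exists_mem_notMem_of_card_lt_card (hSf.trans_lt hD)
  by_cases hkT : k ∈ T
  · obtain ⟨r, hr⟩ := hne
    refine ⟨r, hr, (hTv k hkT r ?_).trans (hc k hk)⟩
    simp only [Finset.mem_sdiff, Finset.mem_union, not_or] at hr ⊢
    exact ⟨hr.1, hr.2.2⟩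
  · exact ⟨k, by simp [hDA hk, hkS, hkT], hc k hk⟩

variable [Fintype V] {g : V → ℝ} {gmax gmin : ℝ}

theorem IsTrimmed.isBalanced_of_mem (hR : IsTrimmed A g f R) (hF : F.card ≤ f)
    (hmax : IsGreatest (g '' (R : Set V)) gmax) (hmin : IsLeast (g '' (R : Set V)) gmin)
    {q : V} (hqR : q ∈ R) (hqF : q ∉ F) : IsBalanced (A \ F) g ((gmax + gmin) / 2) q := by
  obtain ⟨r, hr, rfl⟩ := hmax.1
  obtain ⟨s, hs, rfl⟩ := hmin.1
  obtain ⟨u, hu, hru⟩ := hR.exists_le hF hr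
  obtain ⟨l, hl, hls⟩ := hR.exists_ge hF hs
  have hq : q ∈ A \ F := Finset.mem_sdiff.2 ⟨hR.subset hqR, hqF⟩
  have hqr : g q ≤ g r := hmax.2 ⟨q, hqR, rfl⟩
  have hsq : g s ≤ g q := hmin.2 ⟨q, hqR, rfl⟩
  rcases le_total (g q) ((g r + g s) / 2) with hle | hge
  · exact isBalanced_of_mem_uIcc hq hu (Set.mem_uIcc_of_le hle (by linarith))
  · exact isBalanced_of_mem_uIcc hq hl (Set.mem_uIcc_of_ge (by linarith) hge)

-- An erased small value and an erased large value cannot both fail to be balanced, so that one of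
-- the two erased sets contains all the agents that are not.
theorem IsTrimmed.exists_forall_isBalanced (hR : IsTrimmed A g f R) (hF : F.card ≤ f)
    (hmax : IsGreatest (g '' (R : Set V)) gmax) (hmin : IsLeast (g '' (R : Set V)) gmin) :
    ∃ E : Finset V, E.card ≤ f ∧
      ∀ q ∈ (A \ F) \ E, IsBalanced (A \ F) g ((gmax + gmin) / 2) q := by
  have hkept := fun q => hR.isBalanced_of_mem (q := q) hF hmax hmin
  obtain ⟨S, T, hS, hT, hST, hSf, hTf, hSv, hTv, rfl⟩ := hR
  have hle : gmin ≤ gmax := hmax.2 hmin.1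
  have hSmin : ∀ s ∈ S, g s ≤ gmin := fun s hs => by
    obtain ⟨r, hr, rfl⟩ := hmin.1
    exact hSv s hs r (by grind)
  have hTmax : ∀ t ∈ T, gmax ≤ g t := fun t ht => by
    obtain ⟨r, hr, rfl⟩ := hmax.1
    exact hTv t ht r (by grind)
  by_cases hall : ∀ s ∈ S \ F, IsBalanced (A \ F) g ((gmax + gmin) / 2) s
  · refine ⟨T, hTf.le, fun q hq => ?_⟩
    by_cases hqS : q ∈ S
    · exact hall q (by grind)
    · exact hkept q (by grind) (by grind)
  · push Not at hall
    obtain ⟨s, hs, hsbad⟩ := hall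
    refine ⟨S, hSf.le, fun q hq => ?_⟩
    by_cases hqT : q ∈ T
    · have hsmin := hSmin s (by grind)
      have hqmax := hTmax q hqT
      exact (isBalanced_or_isBalanced (by grind) (by grind) (by linarith)
        (by linarith)).resolve_left hsbad
    · exact hkept q (by grind) (by grind)

theorem IsTrimmed.exists_mem_validWeights (hR : IsTrimmed A g f R) (hF : F.card ≤ f)
    (hmax : IsGreatest (g '' (R : Set V)) gmax) (hmin : IsLeast (g '' (R : Set V)) gmin)
    {d : V → ℝ} (hd : ∀ i ∈ A, i ∉ F → g i = d i) {m : ℕ} (hm0 : 0 < m)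
    (hm : m + f ≤ (A \ F).card) {β γ : ℝ} (hβ : β ≤ 1 / (2 * (m : ℝ))) (hγ : γ ≤ m) :
    ∃ α ∈ validWeights Fᶜ β γ, α ⬝ᵥ d = (gmax + gmin) / 2 := by
  obtain ⟨E, hE, hbal⟩ := hR.exists_forall_isBalanced hF hmax hmin
  have hcard := Finset.le_card_sdiff E (A \ F)
  obtain ⟨Q, hQ, rfl⟩ := Finset.exists_subset_card_eq (show m ≤ ((A \ F) \ E).card by omega)
  obtain ⟨α, hα, hαg, hαQ⟩ := exists_mem_simplexOn_of_forall_isBalanced (Finset.card_pos.1 hm0)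
    fun q hq => hbal q (hQ hq)
  have hsub : A \ F ⊆ Fᶜ := fun i hi => Finset.mem_compl.2 (Finset.mem_sdiff.1 hi).2
  have hgd : ∀ i ∈ A \ F, g i = d i := fun i hi =>
    hd i (Finset.mem_sdiff.1 hi).1 (Finset.mem_sdiff.1 hi).2
  refine ⟨α, ⟨simplexOn_mono hsub hα, hγ.trans (Nat.cast_le.2 (Finset.card_le_card ?_))⟩, ?_⟩
  · exact fun q hq => Finset.mem_filter.2
      ⟨hsub (Finset.sdiff_subset (hQ hq)), hβ.trans (hαQ q hq)⟩
  · rw [← hαg, dotProduct_eq_sum_of_mem_simplexOn hα, dotProduct_eq_sum_of_mem_simplexOn hα]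
    exact Finset.sum_congr rfl fun i hi => by rw [hgd i hi]

end Trimming

section Network

variable {V : Type*} [Fintype V] [DecidableEq V] {G : Digraph V} {F A B : Finset V} {f : ℕ} {j : V}

omit [DecidableEq V] in
theorem notMem_inNbrs_self (hloop : ¬ G.Adj j j) : j ∉ inNbrs G j := by simp [inNbrs, hloop]

/-- The graph obtained from `G` by removing `F` and all the edges that enter `A` or `B` from
outside. When it is a reduced graph, its source component lies in both `A` and `B`. -/
def cutGraph (G : Digraph V) (F A B : Finset V) : Digraph V :=
  ⟨fun u v => (G.Adj u v ∧ u ∉ F ∧ v ∉ F) ∧ (v ∈ A → u ∈ A) ∧ (v ∈ B → u ∈ B)⟩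

theorem isReducedGraph_cutGraph (hAB : Disjoint A B)
    (hA : ∀ i ∈ A, ((inNbrs G i \ F) \ A).card ≤ f)
    (hB : ∀ i ∈ B, ((inNbrs G i \ F) \ B).card ≤ f) : IsReducedGraph G F f (cutGraph G F A B) := by
  have hremoved : ∀ i ∉ F, ∀ u ∈ inNbrs G i, u ∉ F → ¬ (cutGraph G F A B).Adj u i →
      i ∈ A ∧ u ∉ A ∨ i ∈ B ∧ u ∉ B := by
    intro i hi u hu huF hadj
    simp only [inNbrs, Finset.mem_filter, Finset.mem_univ, true_and] at hu
    simp only [cutGraph] at hadj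
    tauto
  refine ⟨fun u v huv => huv.1, fun i hi => ?_⟩
  by_cases hiA : i ∈ A
  · have hiB := Finset.disjoint_left.1 hAB hiA
    exact (Finset.card_le_card fun u hu => by grind).trans (hA i hiA)
  by_cases hiB : i ∈ B
  · exact (Finset.card_le_card fun u hu => by grind).trans (hB i hiB)
  refine (Finset.card_eq_zero.2 (Finset.eq_empty_of_forall_notMem fun u hu => ?_)).trans_le
    f.zero_le
  simp only [Finset.mem_filter] at hu
  have := hremoved i hi u hu.1 hu.2.1 hu.2.2
  tauto

omit [Fintype V] [DecidableEq V] in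
theorem mem_of_reflTransGen {H : Digraph V} {s a : V} (hA : ∀ u v, H.Adj u v → v ∈ A → u ∈ A)
    (hsa : Relation.ReflTransGen H.Adj s a) (ha : a ∈ A) : s ∈ A := by
  induction hsa using Relation.ReflTransGen.head_induction_on with
  | refl => exact ha
  | head huv _ ih => exact hA _ _ huv ih

theorem EveryReducedGraphHasSource.exists_card_lt (hG : EveryReducedGraphHasSource G f)
    (hF : F.card ≤ f) (hA : A.Nonempty) (hB : B.Nonempty) (hAB : Disjoint A B) (hAF : A ⊆ Fᶜ)
    (hBF : B ⊆ Fᶜ) :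
    (∃ i ∈ A, f < ((inNbrs G i \ F) \ A).card) ∨ (∃ i ∈ B, f < ((inNbrs G i \ F) \ B).card) := by
  by_contra! hcon
  obtain ⟨s, -, hs⟩ := hG F hF _ (isReducedGraph_cutGraph hAB hcon.1 hcon.2)
  obtain ⟨a, ha⟩ := hA
  obtain ⟨b, hb⟩ := hB
  have hsA := mem_of_reflTransGen (H := cutGraph G F A B) (fun _ _ huv => huv.2.1)
    (hs a (by simpa using hAF ha)) ha
  have hsB := mem_of_reflTransGen (H := cutGraph G F A B) (fun _ _ huv => huv.2.2)
    (hs b (by simpa using hBF hb)) hb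
  exact Finset.disjoint_left.1 hAB hsA hsB

-- If the in-degree of `j` were `2 f`, then for a faulty set of `f` in-neighbours of `j` neither `j`
-- nor the other non-faulty agents would hear from more than `f` agents across the cut `{j}`.
theorem EveryReducedGraphHasSource.inDeg_ne_two_mul (hG : EveryReducedGraphHasSource G f)
    (hloop : ¬ G.Adj j j) (hj : f < inDeg G j) : inDeg G j ≠ 2 * f := by
  intro hdeg
  rw [inDeg] at hj hdeg
  obtain ⟨F, hFs, hFf⟩ := Finset.exists_subset_card_eq hj.le
  have hjn := notMem_inNbrs_self hloop
  have hcard : (inNbrs G j \ F).card = f := by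
    rw [Finset.card_sdiff_of_subset hFs]
    omega
  obtain ⟨w, hw⟩ : (inNbrs G j \ F).Nonempty := Finset.card_pos.1 (by omega)
  rcases hG.exists_card_lt hFf.le (Finset.singleton_nonempty j) (B := (insert j F)ᶜ)
    ⟨w, by grind [Finset.mem_compl]⟩ (by simp) (by grind [Finset.mem_compl])
    (by grind [Finset.mem_compl]) with ⟨i, hi, hlt⟩ | ⟨i, -, hlt⟩
  · obtain rfl := Finset.mem_singleton.1 hi
    have hle := Finset.card_le_card (Finset.sdiff_subset : (inNbrs G i \ F) \ {i} ⊆ _)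
    omega
  · have hsub : (inNbrs G i \ F) \ (insert j F)ᶜ ⊆ {j} := fun a ha => by grind [Finset.mem_compl]
    have hle := Finset.card_le_card hsub
    rw [Finset.card_singleton] at hle
    omega

theorem slack_eq_card_sub (hloop : ¬ G.Adj j j) (hj : j ∉ F) :
    slack G F f j = ((insert j (inNbrs G j) \ F).card : ℝ) - f := by
  have hcard : (insert j (inNbrs G j) \ F).card + (inNbrs G j ∩ F).card = inDeg G j + 1 := by
    rw [← Finset.insert_inter_of_notMem hj, Finset.card_sdiff_add_card_inter,
      Finset.card_insert_of_notMem (notMem_inNbrs_self hloop), inDeg]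
  have hcast : ((insert j (inNbrs G j) \ F).card : ℝ) + (inNbrs G j ∩ F).card = inDeg G j + 1 := by
    exact_mod_cast hcard
  rw [slack]
  linarith

theorem gammaTilde_le_card (hloop : ∀ i, ¬ G.Adj i i) (hN : Fᶜ.Nonempty) :
    gammaTilde G F f hN ≤ (Fᶜ.card : ℝ) := by
  obtain ⟨j, hj⟩ := id hN
  have hcard : ((insert j (inNbrs G j) \ F).card : ℝ) ≤ (Fᶜ.card : ℝ) :=
    Nat.cast_le.2 (Finset.card_le_card fun i hi => by grind [Finset.mem_compl])
  calc gammaTilde G F f hN ≤ slack G F f j := Finset.inf'_le _ hj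
    _ = ((insert j (inNbrs G j) \ F).card : ℝ) - f :=
        slack_eq_card_sub (hloop j) (Finset.mem_compl.1 hj)
    _ ≤ (Fᶜ.card : ℝ) := (sub_le_self _ f.cast_nonneg).trans hcard

theorem IsTrimmed.exists_mem_validWeights_tilde (hloop : ¬ G.Adj j j) (hN : Fᶜ.Nonempty)
    (hF : F.card ≤ f) (hj : j ∉ F) {g : V → ℝ} {R : Finset V}
    (hR : IsTrimmed (insert j (inNbrs G j)) g f R) {gmax gmin : ℝ}
    (hmax : IsGreatest (g '' (R : Set V)) gmax) (hmin : IsLeast (g '' (R : Set V)) gmin)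
    {d : V → ℝ} (hd : ∀ i ∈ insert j (inNbrs G j), i ∉ F → g i = d i) :
    ∃ α ∈ validWeights Fᶜ (betaTilde G F f hN) (gammaTilde G F f hN),
      α ⬝ᵥ d = (gmax + gmin) / 2 := by
  have hRpos : 0 < R.card := by
    obtain ⟨r, hr, -⟩ := hmax.1
    exact Finset.card_pos.2 ⟨r, hr⟩
  have hRcard := hR.card_add
  have hle := Finset.le_card_sdiff F (insert j (inNbrs G j))
  obtain ⟨m, hm⟩ : ∃ m, (insert j (inNbrs G j) \ F).card = m + f :=
    ⟨(insert j (inNbrs G j) \ F).card - f, by omega⟩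
  have hslack : slack G F f j = m := by
    rw [slack_eq_card_sub hloop hj, hm]
    simp
  have hm0 : 0 < m := by omega
  have hsup : (m : ℝ) ≤ Fᶜ.sup' hN (slack G F f) :=
    hslack ▸ Finset.le_sup' _ (Finset.mem_compl.2 hj)
  have hinf : gammaTilde G F f hN ≤ m :=
    hslack ▸ Finset.inf'_le (slack G F f) (Finset.mem_compl.2 hj)
  refine hR.exists_mem_validWeights hF hmax hmin hd hm0 hm.ge ((min_le_left _ _).trans ?_) hinf
  have hm0' : (0 : ℝ) < m := Nat.cast_pos.2 hm0
  exact one_div_le_one_div_of_le (by positivity) (by linarith)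

end Network

section Pull

variable {V : Type*} [Fintype V] [DecidableEq V] {G : Digraph V} {F R : Finset V} {f : ℕ}
  {x w : V → ℝ} {j : V} {c μ v v' : ℝ}

/-- Agent `j`, or more than `f` of its incoming neighbours outside `F`, have a value at most `c`.
This forces a value at most `c` into the trimmed mean of `j`. -/
def PulledBelow (G : Digraph V) (F : Finset V) (f : ℕ) (x : V → ℝ) (j : V) (c : ℝ) : Prop :=
  x j ≤ c ∨ ∃ D ⊆ inNbrs G j \ F, f < D.card ∧ ∀ i ∈ D, x i ≤ c

/-- The new value `v` of agent `j` obeys the upper bounds of a trimmed mean of the values `x`: it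
does not exceed a common upper bound `B`, and it stays `μ * ε` away from `B` if `j` is pulled below
`B - ε`. -/
def RespectsPull (G : Digraph V) (F : Finset V) (f : ℕ) (μ : ℝ) (x : V → ℝ) (j : V) (v : ℝ) :
    Prop :=
  ∀ B ε, 0 ≤ ε → (∀ i ∉ F, x i ≤ B) → PulledBelow G F f x j (B - ε) → v ≤ B - μ * ε

theorem RespectsPull.mono (hv : RespectsPull G F f μ x j v) (hle : v' ≤ v) :
    RespectsPull G F f μ x j v' := fun B ε hε hB hj => hle.trans (hv B ε hε hB hj)

theorem RespectsPull.le (hv : RespectsPull G F f μ x j v) (hj : j ∉ F) {B : ℝ}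
    (hB : ∀ i ∉ F, x i ≤ B) : v ≤ B := by
  simpa using hv B 0 le_rfl hB (.inl (by simpa using hB j hj))

theorem sum_div_card_le_sub_div {ι : Type*} {S : Finset ι} {w : ι → ℝ} {B ε : ℝ} {r : ι}
    (hw : ∀ i ∈ S, w i ≤ B) (hr : r ∈ S) (hrB : w r ≤ B - ε) :
    (∑ i ∈ S, w i) / S.card ≤ B - ε / S.card := by
  have hS : (0 : ℝ) < S.card := Nat.cast_pos.2 (Finset.card_pos.2 ⟨r, hr⟩)
  have hgap : ε ≤ ∑ i ∈ S, (B - w i) := (le_sub_comm.1 hrB).trans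
    (Finset.single_le_sum (f := fun i => B - w i) (fun i hi => sub_nonneg.2 (hw i hi)) hr)
  rw [Finset.sum_sub_distrib, Finset.sum_const, nsmul_eq_mul] at hgap
  rw [div_le_iff₀ hS, sub_mul, div_mul_cancel₀ ε hS.ne']
  linarith

theorem IsTrimmed.exists_mem_insert_le (hR : IsTrimmed (inNbrs G j) w f R)
    (hG : EveryReducedGraphHasSource G f) (hloop : ¬ G.Adj j j) (hj : j ∉ F)
    (hw : ∀ i ∈ insert j (inNbrs G j), i ∉ F → w i = x i) (hc : PulledBelow G F f x j c) :
    ∃ r ∈ insert j R, w r ≤ c := by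
  rcases hc with hjc | ⟨D, hD, hDf, hDc⟩
  · exact ⟨j, Finset.mem_insert_self j R, (hw j (Finset.mem_insert_self _ _) hj).trans_le hjc⟩
  have hDA : D ⊆ inNbrs G j := hD.trans Finset.sdiff_subset
  have hdeg := hG.inDeg_ne_two_mul hloop (hDf.trans_le (Finset.card_le_card hDA))
  have hRcard := hR.card_add
  have hne : R.Nonempty := Finset.card_pos.1 (by rw [inDeg] at hdeg; omega)
  obtain ⟨r, hr, hrc⟩ := hR.exists_mem_le hne hDA hDf fun i hi =>
    (hw i (Finset.mem_insert_of_mem (hDA hi)) (Finset.mem_sdiff.1 (hD hi)).2).trans_le (hDc i hi)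
  exact ⟨r, Finset.mem_insert_of_mem hr, hrc⟩

theorem IsTrimmed.respectsPull (hR : IsTrimmed (inNbrs G j) w f R)
    (hG : EveryReducedGraphHasSource G f) (hF : F.card ≤ f) (hloop : ¬ G.Adj j j) (hj : j ∉ F)
    (hw : ∀ i ∈ insert j (inNbrs G j), i ∉ F → w i = x i) :
    RespectsPull G F f (1 / Fintype.card V) x j
      ((∑ i ∈ insert j R, w i) / (insert j R).card) := by
  intro B ε hε hB hpull
  have hwB : ∀ i ∈ insert j (inNbrs G j), i ∉ F → w i ≤ B := fun i hi hiF =>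
    (hw i hi hiF).trans_le (hB i hiF)
  have hle : ∀ i ∈ insert j R, w i ≤ B := by
    intro i hi
    rcases Finset.mem_insert.1 hi with rfl | hi
    · exact hwB i (Finset.mem_insert_self _ _) hj
    · obtain ⟨u, hu, hwu⟩ := hR.exists_le hF hi
      obtain ⟨huj, huF⟩ := Finset.mem_sdiff.1 hu
      exact hwu.trans (hwB u (Finset.mem_insert_of_mem huj) huF)
  obtain ⟨r, hr, hrB⟩ := hR.exists_mem_insert_le hG hloop hj hw hpull
  have hpos : (0 : ℝ) < (insert j R).card := Nat.cast_pos.2 (Finset.card_pos.2 ⟨r, hr⟩)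
  have hcard : ((insert j R).card : ℝ) ≤ Fintype.card V := Nat.cast_le.2 (Finset.card_le_univ _)
  calc (∑ i ∈ insert j R, w i) / (insert j R).card
      ≤ B - ε / (insert j R).card := sum_div_card_le_sub_div hle hr hrB
    _ ≤ B - ε / Fintype.card V := sub_le_sub_left (div_le_div_of_nonneg_left hε hpos hcard) B
    _ = B - 1 / Fintype.card V * ε := by ring

end Pull

section Consensus

theorem eq_empty_or_eq_empty_of_ssubset {α : Type*} {P Q : ℕ → Finset α} {n : ℕ}
    (hP : ∀ k, P (k + 1) ⊆ P k) (hQ : ∀ k, Q (k + 1) ⊆ Q k)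
    (hlt : ∀ k, (P k).Nonempty → (Q k).Nonempty → P (k + 1) ⊂ P k ∨ Q (k + 1) ⊂ Q k)
    (hn : (P 0).card + (Q 0).card ≤ n) : P n = ∅ ∨ Q n = ∅ := by
  have hdecr : ∀ k, P k = ∅ ∨ Q k = ∅ ∨ (P k).card + (Q k).card + k ≤ n := by
    intro k
    induction k with
    | zero => exact .inr (.inr hn)
    | succ k ih =>
      rcases (P k).eq_empty_or_nonempty with hPe | hPne
      · exact .inl (Finset.subset_empty.1 (hPe ▸ hP k))
      rcases (Q k).eq_empty_or_nonempty with hQe | hQne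
      · exact .inr (.inl (Finset.subset_empty.1 (hQe ▸ hQ k)))
      have hk := (ih.resolve_left hPne.ne_empty).resolve_left hQne.ne_empty
      have hPle := Finset.card_le_card (hP k)
      have hQle := Finset.card_le_card (hQ k)
      rcases hlt k hPne hQne with hss | hss
      all_goals
        have hcard := Finset.card_lt_card hss
        exact .inr (.inr (by omega))
  refine (hdecr n).imp_right fun h => h.elim id fun hcard => Finset.card_eq_zero.1 (by omega)

variable {V : Type*} [Fintype V] [DecidableEq V] {G : Digraph V} {F : Finset V} {f : ℕ} {μ : ℝ}

/-- The agents outside `F` whose value exceeds `c`. -/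
noncomputable def topAgents (F : Finset V) (x : V → ℝ) (c : ℝ) : Finset V :=
  Fᶜ.filter fun i => c < x i

theorem notMem_topAgents {x : V → ℝ} {c : ℝ} {i : V} (hi : i ∉ F) :
    i ∉ topAgents F x c ↔ x i ≤ c := by
  simp [topAgents, hi]

section OneSided

variable {y : ℕ → V → ℝ} {e : ℕ → ℝ} {B r : ℝ}
  (hy : ∀ k, ∀ j ∉ F, RespectsPull G F f μ (y k) j (y (k + 1) j - e k))
  (hB : ∀ i ∉ F, y 0 i ≤ B)

/-- The level below which an agent stays after `k` steps, with errors `e`, once it has been below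
`B - r` or, through its neighbours, has been pulled below an earlier level. -/
noncomputable def pullLevel (μ B r : ℝ) (e : ℕ → ℝ) (k : ℕ) : ℝ :=
  B + ∑ s ∈ Finset.range k, e s - μ ^ k * r

include hy hB

theorem le_add_sum_of_respectsPull (k : ℕ) :
    ∀ i ∉ F, y k i ≤ B + ∑ s ∈ Finset.range k, e s := by
  induction k with
  | zero => simpa using hB
  | succ k ih =>
    intro i hi
    have hle := (hy k i hi).le hi ih
    rw [Finset.sum_range_succ]
    linarith

variable (hμ : 0 ≤ μ) (hr : 0 ≤ r)
include hμ hr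

theorem le_pullLevel_succ {k : ℕ} {i : V} (hi : i ∉ F)
    (hpull : PulledBelow G F f (y k) i (pullLevel μ B r e k)) :
    y (k + 1) i ≤ pullLevel μ B r e (k + 1) := by
  have hle := hy k i hi _ (μ ^ k * r) (by positivity) (le_add_sum_of_respectsPull hy hB k) hpull
  rw [pullLevel, Finset.sum_range_succ, pow_succ']
  linarith

theorem topAgents_pullLevel_succ_subset (k : ℕ) :
    topAgents F (y (k + 1)) (pullLevel μ B r e (k + 1)) ⊆
      topAgents F (y k) (pullLevel μ B r e k) := by
  intro i hi
  have hiF : i ∉ F := Finset.mem_compl.1 (Finset.mem_filter.1 hi).1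
  by_contra hlow
  exact (notMem_topAgents hiF).2 (le_pullLevel_succ hy hB hμ hr hiF
    (.inl ((notMem_topAgents hiF).1 hlow))) hi

theorem topAgents_pullLevel_succ_ssubset {k : ℕ} {i : V}
    (hi : i ∈ topAgents F (y k) (pullLevel μ B r e k))
    (hlt : f < ((inNbrs G i \ F) \ topAgents F (y k) (pullLevel μ B r e k)).card) :
    topAgents F (y (k + 1)) (pullLevel μ B r e (k + 1)) ⊂
      topAgents F (y k) (pullLevel μ B r e k) := by
  have hiF : i ∉ F := Finset.mem_compl.1 (Finset.mem_filter.1 hi).1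
  refine (Finset.ssubset_iff_of_subset (topAgents_pullLevel_succ_subset hy hB hμ hr k)).2
    ⟨i, hi, (notMem_topAgents hiF).2 (le_pullLevel_succ hy hB hμ hr hiF
      (.inr ⟨_, Finset.sdiff_subset, hlt, fun u hu => ?_⟩))⟩
  obtain ⟨hu, hulow⟩ := Finset.mem_sdiff.1 hu
  exact (notMem_topAgents (Finset.mem_sdiff.1 hu).2).1 hulow

end OneSided

section TwoSided

variable {y : ℕ → V → ℝ} {e : ℕ → ℝ} {B B' : ℝ}

theorem disjoint_topAgents_pullLevel (hμ0 : 0 ≤ μ) (hμ1 : μ ≤ 1) (he : ∀ k, 0 ≤ e k)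
    (hBB' : 0 ≤ B + B') (k : ℕ) :
    Disjoint (topAgents F (y k) (pullLevel μ B ((B + B') / 2) e k))
      (topAgents F (-y k) (pullLevel μ B' ((B + B') / 2) e k)) := by
  refine Finset.disjoint_left.2 fun i hi hi' => ?_
  have hlt : pullLevel μ B ((B + B') / 2) e k < y k i := (Finset.mem_filter.1 hi).2
  have hlt' : pullLevel μ B' ((B + B') / 2) e k < -y k i := (Finset.mem_filter.1 hi').2
  have hpow : μ ^ k * ((B + B') / 2) ≤ (B + B') / 2 :=
    mul_le_of_le_one_left (by linarith) (pow_le_one₀ hμ0 hμ1)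
  have hsum : 0 ≤ ∑ s ∈ Finset.range k, e s := Finset.sum_nonneg fun s _ => he s
  rw [pullLevel] at hlt hlt'
  linarith

variable (hG : EveryReducedGraphHasSource G f) (hF : F.card ≤ f) (hμ1 : μ ≤ 1)
include hG hF hμ1

theorem topAgents_eq_empty_or_eq_empty (hμ0 : 0 ≤ μ) (he : ∀ k, 0 ≤ e k)
    (hup : ∀ k, ∀ j ∉ F, RespectsPull G F f μ (y k) j (y (k + 1) j - e k))
    (hdown : ∀ k, ∀ j ∉ F, RespectsPull G F f μ (-y k) j (-y (k + 1) j - e k))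
    (hB : ∀ i ∉ F, y 0 i ≤ B) (hB' : ∀ i ∉ F, -y 0 i ≤ B') (hBB' : 0 ≤ B + B') :
    topAgents F (y Fᶜ.card) (pullLevel μ B ((B + B') / 2) e Fᶜ.card) = ∅ ∨
      topAgents F (-y Fᶜ.card) (pullLevel μ B' ((B + B') / 2) e Fᶜ.card) = ∅ := by
  have hr : 0 ≤ (B + B') / 2 := by linarith
  have hdisj := disjoint_topAgents_pullLevel (F := F) (y := y) hμ0 hμ1 he hBB'
  refine eq_empty_or_eq_empty_of_ssubset
    (P := fun k => topAgents F (y k) (pullLevel μ B ((B + B') / 2) e k))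
    (Q := fun k => topAgents F (-y k) (pullLevel μ B' ((B + B') / 2) e k))
    (topAgents_pullLevel_succ_subset hup hB hμ0 hr)
    (topAgents_pullLevel_succ_subset (y := fun k => -y k) hdown hB' hμ0 hr) (fun k hP hQ => ?_) ?_
  · rcases hG.exists_card_lt hF hP hQ (hdisj k) (Finset.filter_subset _ _)
      (Finset.filter_subset _ _) with ⟨i, hi, hlt⟩ | ⟨i, hi, hlt⟩
    · exact .inl (topAgents_pullLevel_succ_ssubset hup hB hμ0 hr hi hlt)
    · exact .inr (topAgents_pullLevel_succ_ssubset (y := fun k => -y k) hdown hB' hμ0 hr hi hlt)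
  · rw [← Finset.card_union_of_disjoint (hdisj 0)]
    exact Finset.card_le_card
      (Finset.union_subset (Finset.filter_subset _ _) (Finset.filter_subset _ _))

theorem sub_le_of_respectsPull (hμ0 : 0 ≤ μ) (he : ∀ k, 0 ≤ e k)
    (hup : ∀ k, ∀ j ∉ F, RespectsPull G F f μ (y k) j (y (k + 1) j - e k))
    (hdown : ∀ k, ∀ j ∉ F, RespectsPull G F f μ (-y k) j (-y (k + 1) j - e k))
    (hB : ∀ i ∉ F, y 0 i ≤ B) (hB' : ∀ i ∉ F, -y 0 i ≤ B') {i k : V} (hi : i ∉ F) (hk : k ∉ F) :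
    y Fᶜ.card i - y Fᶜ.card k ≤
      (1 - μ ^ Fᶜ.card / 2) * (B + B') + 2 * ∑ s ∈ Finset.range Fᶜ.card, e s := by
  have hBB' : 0 ≤ B + B' := by linarith [hB i hi, hB' i hi]
  have hpow : 0 ≤ μ ^ Fᶜ.card * (B + B') := by positivity
  have hile := le_add_sum_of_respectsPull hup hB Fᶜ.card i hi
  have hkle := le_add_sum_of_respectsPull (y := fun k => -y k) hdown hB' Fᶜ.card k hk
  rw [Pi.neg_apply] at hkle
  rcases topAgents_eq_empty_or_eq_empty hG hF hμ1 hμ0 he hup hdown hB hB' hBB' with hP | hQ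
  · have hlevel := (notMem_topAgents hi).1 (hP ▸ Finset.notMem_empty i)
    rw [pullLevel] at hlevel
    linarith
  · have hlevel := (notMem_topAgents hk).1 (hQ ▸ Finset.notMem_empty k)
    rw [pullLevel, Pi.neg_apply] at hlevel
    linarith

end TwoSided

end Consensus

section Spread

theorem eventually_atTop_of_forall_mod {p : ℕ → Prop} {n : ℕ} (hn : n ≠ 0)
    (hp : ∀ r < n, ∀ᶠ k in atTop, p (r + k * n)) : ∀ᶠ t in atTop, p t := by
  have hall : ∀ᶠ k in atTop, ∀ r ∈ Finset.range n, p (r + k * n) :=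
    (eventually_all_finset _).2 fun r hr => hp r (Finset.mem_range.1 hr)
  filter_upwards [(Nat.tendsto_div_const_atTop hn).eventually hall] with t ht
  rw [← Nat.mod_add_div' t n]
  exact ht (t % n) (Finset.mem_range.2 (Nat.mod_lt t (Nat.pos_of_ne_zero hn)))

theorem eventually_lt_of_le_mul {u : ℕ → ℝ} {ρ ε : ℝ} {n : ℕ} (hn : n ≠ 0) (hρ0 : 0 ≤ ρ)
    (hρ1 : ρ < 1) (hε : 0 < ε) (hu : ∀ᶠ t in atTop, u (t + n) ≤ ρ * u t) :
    ∀ᶠ t in atTop, u t < ε := by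
  obtain ⟨T, hT⟩ := eventually_atTop.1 hu
  rw [← map_add_atTop_eq_nat T, eventually_map]
  refine eventually_atTop_of_forall_mod hn fun r _ => ?_
  have hgeom : ∀ k, u (r + k * n + T) ≤ ρ ^ k * u (r + T) := fun k => by
    simpa using le_geom (u := fun k => u (r + k * n + T)) hρ0 k fun i _ => by
      simpa only [add_mul, one_mul, add_assoc, add_comm n T] using hT (r + i * n + T) (by omega)
  have hlim : Tendsto (fun k => ρ ^ k * u (r + T)) atTop (𝓝 0) := by
    simpa using (tendsto_pow_atTop_nhds_zero_of_lt_one hρ0 hρ1).mul_const (u (r + T))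
  filter_upwards [hlim.eventually (gt_mem_nhds hε)] with k hk
  exact (hgeom k).trans_lt hk

theorem eventually_lt_of_le_mul_add {u e : ℕ → ℝ} {ρ ε : ℝ} {n : ℕ} (hn : n ≠ 0) (hρ0 : 0 ≤ ρ)
    (hρ1 : ρ < 1) (hε : 0 < ε) (hu : ∀ t, u (t + n) ≤ ρ * u t + e t)
    (he : Tendsto e atTop (𝓝 0)) : ∀ᶠ t in atTop, u t < ε := by
  have hpos : 0 < (1 - ρ) * (ε / 2) := mul_pos (sub_pos.2 hρ1) (half_pos hε)
  have hcontr : ∀ᶠ t in atTop, u (t + n) - ε / 2 ≤ ρ * (u t - ε / 2) := by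
    filter_upwards [he.eventually (gt_mem_nhds hpos)] with t ht
    linarith [hu t]
  filter_upwards [eventually_lt_of_le_mul (u := fun t => u t - ε / 2) hn hρ0 hρ1 (half_pos hε)
    hcontr] with t ht
  linarith

variable {V : Type*} [Fintype V] [DecidableEq V] {G : Digraph V} {F : Finset V} {f : ℕ} {μ : ℝ}

theorem eventually_sub_lt_of_respectsPull (hG : EveryReducedGraphHasSource G f) (hF : F.card ≤ f)
    (hμ0 : 0 < μ) (hμ1 : μ ≤ 1) {x : ℕ → V → ℝ} {e : ℕ → ℝ} (he : ∀ t, 0 ≤ e t)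
    (hlim : Tendsto e atTop (𝓝 0))
    (hup : ∀ t, ∀ j ∉ F, RespectsPull G F f μ (x t) j (x (t + 1) j - e t))
    (hdown : ∀ t, ∀ j ∉ F, RespectsPull G F f μ (-x t) j (-x (t + 1) j - e t))
    {ε : ℝ} (hε : 0 < ε) : ∀ᶠ t in atTop, ∀ i ∉ F, ∀ k ∉ F, x t i - x t k < ε := by
  have hN := hG.nonempty hF
  set n := Fᶜ.card
  set spread : ℕ → ℝ := fun t => Fᶜ.sup' hN (x t) + Fᶜ.sup' hN (-x t)
  have hle : ∀ (z : V → ℝ), ∀ i ∉ F, z i ≤ Fᶜ.sup' hN z := fun z i hi =>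
    Finset.le_sup' z (Finset.mem_compl.2 hi)
  have hcontr : ∀ t, spread (t + n) ≤
      (1 - μ ^ n / 2) * spread t + 2 * ∑ s ∈ Finset.range n, e (t + s) := by
    intro t
    obtain ⟨i, hi, hi'⟩ := Finset.exists_mem_eq_sup' hN (x (t + n))
    obtain ⟨k, hk, hk'⟩ := Finset.exists_mem_eq_sup' hN (-x (t + n))
    calc spread (t + n) = x (t + n) i - x (t + n) k :=
          (congrArg₂ (· + ·) hi' hk').trans (sub_eq_add_neg _ _).symm
      _ ≤ _ := sub_le_of_respectsPull (y := fun s => x (t + s)) hG hF hμ1 hμ0.le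
          (fun s => he (t + s)) (fun s => hup (t + s)) (fun s => hdown (t + s)) (hle _) (hle _)
          (Finset.mem_compl.1 hi) (Finset.mem_compl.1 hk)
  have herror : Tendsto (fun t => 2 * ∑ s ∈ Finset.range n, e (t + s)) atTop (𝓝 0) := by
    simpa using (tendsto_finsetSum (Finset.range n) fun s _ =>
      hlim.comp (tendsto_add_atTop_nat s)).const_mul 2
  have hpow : μ ^ n ≤ 1 := pow_le_one₀ hμ0.le hμ1
  filter_upwards [eventually_lt_of_le_mul_add hN.card_ne_zero (by linarith)
    (sub_lt_self 1 (by positivity)) hε hcontr herror] with t ht i hi k hk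
  have hki : -x t k ≤ Fᶜ.sup' hN (-x t) := hle (-x t) k hk
  linarith [hle (x t) i hi]

end Spread

section Sequence

variable {M lam : ℕ → ℝ} {c η δ : ℝ}

theorem frequently_le_of_descent (hδ : 0 < δ)
    (hsum : Tendsto (fun n => ∑ t ∈ Finset.range n, lam t) atTop atTop)
    (hdesc : ∀ᶠ t in atTop, c < M t → M (t + 1) ≤ max (M t - lam t * δ) c) :
    ∃ᶠ t in atTop, M t ≤ c := by
  intro hgt
  obtain ⟨T, hT⟩ := eventually_atTop.1 (hgt.and hdesc)
  have habove : ∀ t ≥ T, c < M t := fun t ht => not_le.1 (hT t ht).1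
  have hle : ∀ n ≥ T,
      M n ≤ M T - (∑ t ∈ Finset.range n, lam t - ∑ t ∈ Finset.range T, lam t) * δ := by
    intro n hn
    induction n, hn using Nat.le_induction with
    | base => simp
    | succ n hn ih =>
      have hstep := (le_max_iff.1 ((hT n hn).2 (habove n hn))).resolve_right
        (habove (n + 1) (hn.trans n.le_succ)).not_ge
      rw [Finset.sum_range_succ]
      linarith
  obtain ⟨n, hsum_n, hn⟩ := ((hsum.eventually_ge_atTop
    ((M T - c) / δ + ∑ t ∈ Finset.range T, lam t)).and (eventually_ge_atTop T)).exists
  have hmass := (div_le_iff₀ hδ).1 (le_sub_iff_add_le.2 hsum_n)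
  linarith [hle n hn, habove n hn]

theorem eventually_le_of_descent (hδ : 0 < δ) (hη : 0 ≤ η) (hlam : ∀ t, 0 ≤ lam t)
    (hsum : Tendsto (fun n => ∑ t ∈ Finset.range n, lam t) atTop atTop)
    (hdesc : ∀ᶠ t in atTop, c < M t → M (t + 1) ≤ max (M t - lam t * δ) c)
    (hrise : ∀ᶠ t in atTop, M t ≤ c → M (t + 1) ≤ c + η) : ∀ᶠ t in atTop, M t ≤ c + η := by
  obtain ⟨T, hT⟩ := eventually_atTop.1 (hdesc.and hrise)
  obtain ⟨T', hTT', hT'⟩ := frequently_atTop.1 (frequently_le_of_descent hδ hsum hdesc) T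
  refine eventually_atTop.2 ⟨T', fun t ht => ?_⟩
  induction t, ht using Nat.le_induction with
  | base => linarith
  | succ t ht ih =>
    obtain ⟨hdown, hup⟩ := hT t (hTT'.trans ht)
    rcases le_or_gt (M t) c with hle | hgt
    · exact hup hle
    · have hpos := mul_nonneg (hlam t) hδ.le
      exact (hdown hgt).trans (max_le (by linarith) (by linarith))

end Sequence

theorem infDist_le_of_sub_le_of_le_add {Y : Set ℝ} (hY : Y.OrdConnected) {u y₁ y₂ ε : ℝ}
    (hε : 0 ≤ ε) (hy₁ : y₁ ∈ Y) (hy₂ : y₂ ∈ Y) (hlower : y₁ - ε ≤ u) (hupper : u ≤ y₂ + ε) :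
    Metric.infDist u Y ≤ ε := by
  obtain ⟨y, hy, hle⟩ : ∃ y ∈ Y, |u - y| ≤ ε := by
    rcases le_total u y₁ with h₁ | h₁
    · exact ⟨y₁, hy₁, abs_le.2 ⟨by linarith, by linarith⟩⟩
    rcases le_total y₂ u with h₂ | h₂
    · exact ⟨y₂, hy₂, abs_le.2 ⟨by linarith, by linarith⟩⟩
    · exact ⟨u, hY.out hy₁ hy₂ ⟨h₁, h₂⟩, by simpa using hε⟩
  exact (Metric.infDist_le_dist_of_mem hy).trans hle

section Descent

variable {V : Type*} [Fintype V] [DecidableEq V] {G : Digraph V} {F : Finset V} {f : ℕ}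
  {μ L : ℝ} {X : Set ℝ} {d : V → ℝ → ℝ} {W : Set (V → ℝ)} {lam : ℕ → ℝ} {x : ℕ → V → ℝ}

/-- Every agent outside `F` moves from an approximate mean `v` of its neighbours' estimates along
a combination, with weights in `W`, of the gradients `d` at the estimates, and projects to `X`.
Algorithm 2 is of this form, and the reflection of `ℝ` at `0` preserves it. -/
structure IsResilientDescent (G : Digraph V) (F : Finset V) (f : ℕ) (μ : ℝ) (X : Set ℝ)
    (d : V → ℝ → ℝ) (W : Set (V → ℝ)) (lam : ℕ → ℝ) (x : ℕ → V → ℝ) : Prop where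
  mem : ∀ t, ∀ j ∉ F, x t j ∈ X
  step : ∀ t, ∀ j ∉ F, ∃ v, RespectsPull G F f μ (x t) j v ∧ RespectsPull G F f μ (-x t) j (-v) ∧
    ∃ α ∈ W, IsProjection X (v - lam t * (α ⬝ᵥ fun i => d i (x t i))) (x (t + 1) j)

theorem IsResilientDescent.neg (hx : IsResilientDescent G F f μ X d W lam x) :
    IsResilientDescent G F f μ (-X) (fun i u => -d i (-u)) W lam (-x) := by
  refine ⟨fun t j hj => Set.neg_mem_neg.2 (hx.mem t j hj), fun t j hj => ?_⟩
  obtain ⟨v, hv, hv', α, hα, hproj⟩ := hx.step t j hj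
  refine ⟨-v, hv', by simpa using hv, α, hα, ?_⟩
  have hdot : (α ⬝ᵥ fun i => -d i (x t i)) = -(α ⬝ᵥ fun i => d i (x t i)) :=
    dotProduct_neg α fun i => d i (x t i)
  convert hproj.neg using 1
  · simp only [Pi.neg_apply, neg_neg, hdot]
    ring
  · rfl

theorem mem_of_respectsPull {y : V → ℝ} {j : V} {v : ℝ} (hX : X.OrdConnected)
    (hy : ∀ i ∉ F, y i ∈ X) (hj : j ∉ F) (hv : RespectsPull G F f μ y j v)
    (hv' : RespectsPull G F f μ (-y) j (-v)) : v ∈ X := by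
  have hN : Fᶜ.Nonempty := ⟨j, Finset.mem_compl.2 hj⟩
  obtain ⟨a, ha, hya⟩ := Fᶜ.exists_max_image y hN
  obtain ⟨b, hb, hyb⟩ := Fᶜ.exists_min_image y hN
  refine hX.out (hy b (Finset.mem_compl.1 hb)) (hy a (Finset.mem_compl.1 ha)) ⟨?_, ?_⟩
  · exact neg_le_neg_iff.1 (hv'.le hj fun i hi => neg_le_neg (hyb i (Finset.mem_compl.2 hi)))
  · exact hv.le hj fun i hi => hya i (Finset.mem_compl.2 hi)

theorem exists_mem_forall_lt_le_add {Y : Set ℝ} {u ε : ℝ} (hX : X.OrdConnected) (hYX : Y ⊆ X)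
    (hY : Y.Nonempty) (hu : u ∈ X) (hε : 0 < ε) (huY : ∀ y ∈ Y, y + ε < u) :
    ∃ y ∈ Y, ∃ c ∈ X, (∀ y' ∈ Y, y' < c) ∧ c ≤ y + ε := by
  have hbdd : BddAbove Y := ⟨u, fun y hy => by linarith [huY y hy]⟩
  have hsup : sSup Y ≤ u - ε := csSup_le hY fun y hy => by linarith [huY y hy]
  obtain ⟨y, hy, hlt⟩ := exists_lt_of_lt_csSup hY (sub_lt_self (sSup Y) (half_pos hε))
  have hle := le_csSup hbdd hy
  exact ⟨y, hy, sSup Y + ε / 2, hX.out (hYX hy) hu ⟨by linarith, by linarith⟩,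
    fun y' hy' => by linarith [le_csSup hbdd hy'], by linarith⟩

namespace IsResilientDescent

theorem respectsPull_succ (hx : IsResilientDescent G F f μ X d W lam x) (hX : X.OrdConnected)
    (hW : W ⊆ simplexOn Fᶜ) (hd : ∀ i ∉ F, ∀ u ∈ X, |d i u| ≤ L) {t : ℕ} (hlam : 0 ≤ lam t)
    {j : V} (hj : j ∉ F) : RespectsPull G F f μ (x t) j (x (t + 1) j - lam t * L) := by
  obtain ⟨v, hv, hv', α, hα, hproj⟩ := hx.step t j hj
  have hvX : v ∈ X := mem_of_respectsPull hX (hx.mem t) hj hv hv'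
  have hgrad : |α ⬝ᵥ fun i => d i (x t i)| ≤ L := abs_dotProduct_le_of_mem_simplexOn (hW hα)
    fun i hi => hd i (Finset.mem_compl.1 hi) _ (hx.mem t i (Finset.mem_compl.1 hi))
  have hL : 0 ≤ L := (abs_nonneg _).trans hgrad
  have hmove := mul_le_mul_of_nonneg_left (abs_le.1 hgrad).1 hlam
  refine hv.mono (sub_le_iff_le_add.2 ((hproj.le_max hX hvX).trans (max_le ?_ ?_)))
  · linarith
  · exact le_add_of_nonneg_right (mul_nonneg hlam hL)

theorem eventually_sub_lt (hx : IsResilientDescent G F f μ X d W lam x) (hX : X.OrdConnected)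
    (hW : W ⊆ simplexOn Fᶜ) (hd : ∀ i ∉ F, ∀ u ∈ X, |d i u| ≤ L) (hlam : ∀ t, 0 ≤ lam t)
    (hlim : Tendsto lam atTop (𝓝 0)) (hG : EveryReducedGraphHasSource G f) (hF : F.card ≤ f)
    (hμ0 : 0 < μ) (hμ1 : μ ≤ 1) {ε : ℝ} (hε : 0 < ε) :
    ∀ᶠ t in atTop, ∀ i ∉ F, ∀ k ∉ F, x t i - x t k < ε := by
  obtain ⟨j, hj⟩ := hG.nonempty hF
  have hL : 0 ≤ L := (abs_nonneg _).trans (hd j (Finset.mem_compl.1 hj) _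
    (hx.mem 0 j (Finset.mem_compl.1 hj)))
  have hnegX : (-X).OrdConnected := hX.preimage_anti fun _ _ => neg_le_neg
  have hnegd : ∀ i ∉ F, ∀ u ∈ -X, |(-d i (-u))| ≤ L := fun i hi u hu => by
    rw [abs_neg]
    exact hd i hi _ hu
  exact eventually_sub_lt_of_respectsPull hG hF hμ0 hμ1 (fun t => mul_nonneg (hlam t) hL)
    (by simpa using hlim.mul_const L)
    (fun t _ hi => hx.respectsPull_succ hX hW hd (hlam t) hi)
    (fun t _ hi => hx.neg.respectsPull_succ hnegX hW hnegd (hlam t) hi) hε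

theorem succ_le_max (hx : IsResilientDescent G F f μ X d W lam x) (hX : X.OrdConnected)
    (hW : W ⊆ simplexOn Fᶜ) (hmono : ∀ i ∉ F, MonotoneOn (d i) X) {t : ℕ} (hlam : 0 ≤ lam t)
    {c δ B : ℝ} (hc : c ∈ X) (hδ : ∀ α ∈ W, δ ≤ α ⬝ᵥ fun i => d i c) (hxc : ∀ i ∉ F, c ≤ x t i)
    (hxB : ∀ i ∉ F, x t i ≤ B) {j : V} (hj : j ∉ F) :
    x (t + 1) j ≤ max (B - lam t * δ) c := by
  obtain ⟨v, hv, -, α, hα, hproj⟩ := hx.step t j hj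
  have hgrad : δ ≤ α ⬝ᵥ fun i => d i (x t i) := (hδ α hα).trans
    (dotProduct_le_dotProduct_of_mem_simplexOn (hW hα) fun i hi => by
      have hiF := Finset.mem_compl.1 hi
      exact hmono i hiF hc (hx.mem t i hiF) (hxc i hiF))
  exact (hproj.le_max hX hc).trans (max_le_max_right _
    (sub_le_sub (hv.le hj hxB) (mul_le_mul_of_nonneg_left hgrad hlam)))

variable (hx : IsResilientDescent G F f μ X d W lam x) (hX : X.OrdConnected)
  (hW : W ⊆ simplexOn Fᶜ) (hd : ∀ i ∉ F, ∀ u ∈ X, |d i u| ≤ L)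
  (hmono : ∀ i ∉ F, MonotoneOn (d i) X) (hlam : ∀ t, 0 ≤ lam t) (hlim : Tendsto lam atTop (𝓝 0))
  (hsum : Tendsto (fun n => ∑ t ∈ Finset.range n, lam t) atTop atTop)
  (hG : EveryReducedGraphHasSource G f) (hF : F.card ≤ f) (hμ0 : 0 < μ) (hμ1 : μ ≤ 1)
include hx hX hW hd hmono hlam hlim hsum hG hF hμ0 hμ1

theorem eventually_le_add {c δ ε : ℝ} (hc : c ∈ X) (hδ0 : 0 < δ)
    (hδ : ∀ α ∈ W, δ ≤ α ⬝ᵥ fun i => d i c) (hε : 0 < ε) :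
    ∀ᶠ t in atTop, ∀ i ∉ F, x t i ≤ c + ε := by
  have hN := hG.nonempty hF
  have hxM : ∀ t, ∀ i ∉ F, x t i ≤ Fᶜ.sup' hN (x t) := fun t i hi =>
    Finset.le_sup' (x t) (Finset.mem_compl.2 hi)
  have hspread := hx.eventually_sub_lt hX hW hd hlam hlim hG hF hμ0 hμ1 (half_pos hε)
  have hdesc : ∀ᶠ t in atTop, c + ε / 2 < Fᶜ.sup' hN (x t) →
      Fᶜ.sup' hN (x (t + 1)) ≤ max (Fᶜ.sup' hN (x t) - lam t * δ) (c + ε / 2) := by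
    filter_upwards [hspread] with t ht hgt
    obtain ⟨k, hk, hck⟩ := (Finset.lt_sup'_iff hN).1 hgt
    have hxc : ∀ i ∉ F, c ≤ x t i := fun i hi => by linarith [ht k (Finset.mem_compl.1 hk) i hi]
    exact Finset.sup'_le hN _ fun j hj => (hx.succ_le_max hX hW hmono (hlam t) hc hδ hxc (hxM t)
      (Finset.mem_compl.1 hj)).trans (max_le_max_left _ (by linarith))
  have hrise : ∀ᶠ t in atTop, Fᶜ.sup' hN (x t) ≤ c + ε / 2 →
      Fᶜ.sup' hN (x (t + 1)) ≤ c + ε / 2 + ε / 2 := by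
    have hmove : Tendsto (fun t => lam t * L) atTop (𝓝 0) := by simpa using hlim.mul_const L
    filter_upwards [hmove.eventually (gt_mem_nhds (half_pos hε))] with t ht hle
    refine Finset.sup'_le hN _ fun j hj => ?_
    have hj' := Finset.mem_compl.1 hj
    have hstep := (hx.respectsPull_succ hX hW hd (hlam t) hj').le hj' (hxM t)
    linarith
  filter_upwards [eventually_le_of_descent hδ0 (half_pos hε).le hlam hsum hdesc hrise]
    with t ht i hi
  linarith [hxM t i hi]

theorem eventually_exists_le_add {Y : Set ℝ} (hYX : Y ⊆ X) (hY : Y.Nonempty)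
    (hdY : ∀ c ∈ X, (∀ y ∈ Y, y < c) → ∃ δ > 0, ∀ α ∈ W, δ ≤ α ⬝ᵥ fun i => d i c)
    {ε : ℝ} (hε : 0 < ε) : ∀ᶠ t in atTop, ∀ i ∉ F, ∃ y ∈ Y, x t i ≤ y + ε := by
  by_cases hfar : ∃ u ∈ X, ∀ y ∈ Y, y + ε / 2 < u
  · obtain ⟨u, hu, huY⟩ := hfar
    obtain ⟨y, hy, c, hc, hYc, hcy⟩ :=
      exists_mem_forall_lt_le_add hX hYX hY hu (half_pos hε) huY
    obtain ⟨δ, hδ0, hδ⟩ := hdY c hc hYc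
    filter_upwards [hx.eventually_le_add hX hW hd hmono hlam hlim hsum hG hF hμ0 hμ1 hc hδ0 hδ
      (half_pos hε)] with t ht i hi
    exact ⟨y, hy, by linarith [ht i hi]⟩
  · push Not at hfar
    refine Eventually.of_forall fun t i hi => ?_
    obtain ⟨y, hy, hle⟩ := hfar (x t i) (hx.mem t i hi)
    exact ⟨y, hy, by linarith⟩

theorem eventually_exists_sub_le {Y : Set ℝ} (hYX : Y ⊆ X) (hY : Y.Nonempty)
    (hdY : ∀ c ∈ X, (∀ y ∈ Y, c < y) → ∃ δ > 0, ∀ α ∈ W, δ ≤ α ⬝ᵥ fun i => -d i c)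
    {ε : ℝ} (hε : 0 < ε) : ∀ᶠ t in atTop, ∀ i ∉ F, ∃ y ∈ Y, y - ε ≤ x t i := by
  have hnegd : ∀ i ∉ F, ∀ u ∈ -X, |(-d i (-u))| ≤ L := fun i hi u hu => by
    rw [abs_neg]
    exact hd i hi _ hu
  have hnegmono : ∀ i ∉ F, MonotoneOn (fun u => -d i (-u)) (-X) := fun i hi u hu v hv huv =>
    neg_le_neg (hmono i hi hv hu (neg_le_neg huv))
  have hnegdY : ∀ c ∈ -X, (∀ y ∈ -Y, y < c) → ∃ δ > 0, ∀ α ∈ W, δ ≤ α ⬝ᵥ fun i => -d i (-c) :=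
    fun c hc hYc => hdY (-c) hc fun y hy => neg_lt.1 (hYc (-y) (Set.neg_mem_neg.2 hy))
  filter_upwards [hx.neg.eventually_exists_le_add (hX.preimage_anti fun _ _ => neg_le_neg) hW
    hnegd hnegmono hlam hlim hsum hG hF hμ0 hμ1 (Set.neg_subset_neg.2 hYX) hY.neg hnegdY hε]
    with t ht i hi
  obtain ⟨y, hy, hle⟩ := ht i hi
  rw [Pi.neg_apply, Pi.neg_apply] at hle
  exact ⟨-y, hy, by linarith⟩

theorem tendsto_infDist {Y : Set ℝ} (hYX : Y ⊆ X) (hY : Y.Nonempty) (hYord : Y.OrdConnected)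
    (hdY : ∀ c ∈ X, (∀ y ∈ Y, y < c) → ∃ δ > 0, ∀ α ∈ W, δ ≤ α ⬝ᵥ fun i => d i c)
    (hdY' : ∀ c ∈ X, (∀ y ∈ Y, c < y) → ∃ δ > 0, ∀ α ∈ W, δ ≤ α ⬝ᵥ fun i => -d i c)
    {j : ℕ → V} (hj : ∀ t, j t ∉ F) :
    Tendsto (fun t => Metric.infDist (x t (j t)) Y) atTop (𝓝 0) := by
  refine tendsto_order.2 ⟨fun a ha => Eventually.of_forall fun t =>
    ha.trans_le Metric.infDist_nonneg, fun a ha => ?_⟩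
  filter_upwards [hx.eventually_exists_le_add hX hW hd hmono hlam hlim hsum hG hF hμ0 hμ1 hYX hY
      hdY (half_pos ha),
    hx.eventually_exists_sub_le hX hW hd hmono hlam hlim hsum hG hF hμ0 hμ1 hYX hY
      hdY' (half_pos ha)] with t hupper hlower
  obtain ⟨y₂, hy₂, hle₂⟩ := hupper (j t) (hj t)
  obtain ⟨y₁, hy₁, hle₁⟩ := hlower (j t) (hj t)
  exact (infDist_le_of_sub_le_of_le_add hYord (half_pos ha).le hy₁ hy₂ hle₁ hle₂).trans_lt
    (half_lt_self ha)

end IsResilientDescent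

end Descent

section Algorithm

variable {V : Type*} [Fintype V] [DecidableEq V] {G : Digraph V} {F : Finset V} {f : ℕ}
  {X : Set ℝ} {h : V → ℝ → ℝ}

theorem IsTrimmed.card_insert_inNbrs {j : V} {w : V → ℝ} {R : Finset V}
    (hR : IsTrimmed (inNbrs G j) w f R) (hloop : ¬ G.Adj j j) :
    ((insert j R).card : ℝ) = (inDeg G j : ℝ) + 1 - 2 * (f : ℝ) := by
  have hjR : j ∉ R := fun hj => notMem_inNbrs_self hloop (hR.subset hj)
  rw [Finset.card_insert_of_notMem hjR, inDeg, ← hR.card_add]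
  push_cast
  ring

theorem AlgorithmStep.exists_respectsPull {l : ℝ} {x : V → ℝ} {j : V} {y : ℝ}
    (hstep : AlgorithmStep G F f X h l x j y) (hloop : ¬ G.Adj j j)
    (hG : EveryReducedGraphHasSource G f) (hF : F.card ≤ f) (hN : Fᶜ.Nonempty) (hj : j ∉ F) :
    ∃ v, RespectsPull G F f (1 / Fintype.card V) x j v ∧
      RespectsPull G F f (1 / Fintype.card V) (-x) j (-v) ∧
      ∃ α ∈ validWeights Fᶜ (betaTilde G F f hN) (gammaTilde G F f hN),
        IsProjection X (v - l * (α ⬝ᵥ fun i => derivWithin (h i) X (x i))) y := by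
  obtain ⟨w, g, hwg, R₁, R₂, hR₁, hR₂, gmax, gmin, hmax, hmin, hproj⟩ := hstep
  obtain ⟨α, hα, hαg⟩ := hR₂.exists_mem_validWeights_tilde hloop hN hF hj hmax hmin
    fun i hi hiF => (hwg i hi hiF).2
  have hdown := hR₁.neg.respectsPull (x := -x) hG hF hloop hj
    fun i hi hiF => congrArg Neg.neg (hwg i hi hiF).1
  refine ⟨(∑ i ∈ insert j R₁, w i) / (insert j R₁).card,
    hR₁.respectsPull hG hF hloop hj fun i hi hiF => (hwg i hi hiF).1, ?_, α, hα, ?_⟩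
  · simpa only [Pi.neg_apply, Finset.sum_neg_distrib, neg_div] using hdown
  · rwa [hαg, hR₁.card_insert_inNbrs hloop, div_eq_inv_mul, inv_eq_one_div]

theorem IsExecution.isResilientDescent {lam : ℕ → ℝ} {x : ℕ → V → ℝ}
    (hx : IsExecution G F f X h lam x) (hloop : ∀ i, ¬ G.Adj i i)
    (hG : EveryReducedGraphHasSource G f) (hF : F.card ≤ f) (hN : Fᶜ.Nonempty) :
    IsResilientDescent G F f (1 / Fintype.card V) X (fun i => derivWithin (h i) X)
      (validWeights Fᶜ (betaTilde G F f hN) (gammaTilde G F f hN)) lam x := by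
  have hstep := fun t j hj => (hx.2 t j hj).exists_respectsPull (hloop j) hG hF hN hj
  refine ⟨fun t j hj => ?_, hstep⟩
  cases t with
  | zero => exact hx.1 j hj
  | succ t =>
    obtain ⟨v, -, -, α, -, hproj⟩ := hstep t j hj
    exact hproj.1

end Algorithm

theorem IsStepsize.tendsto_zero {lam : ℕ → ℝ} (hlam : IsStepsize lam) :
    Tendsto lam atTop (𝓝 0) := by
  rw [tendsto_zero_iff_abs_tendsto_zero]
  simpa [Function.comp_def, Real.sqrt_sq_eq_abs] using hlam.sum_sq_finite.tendsto_atTop_zero.sqrt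

end ByzantineOpt

open ByzantineOpt in
theorem mainTheorem2_general {V : Type*} [Fintype V] [DecidableEq V] {G : Digraph V}
    (hloop : ∀ i, ¬ G.Adj i i) {f : ℕ} (hG : EveryReducedGraphHasSource G f) {F : Finset V}
    (hF : F.card ≤ f) {X : Set ℝ} {L : ℝ} {h : V → ℝ → ℝ}
    (hh : ∀ i ∉ F, IsConvexCost X (h i))
    (hgrad : ∀ i ∉ F, ∀ u ∈ X, |derivWithin (h i) X u| ≤ L) {lam : ℕ → ℝ}
    (hlam : ∀ t, 0 ≤ lam t) (hlim : Tendsto lam atTop (𝓝 0))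
    (hsum : Tendsto (fun n => ∑ t ∈ Finset.range n, lam t) atTop atTop)
    {x : ℕ → V → ℝ} (hx : IsExecution G F f X h lam x) {Y : Set ℝ}
    (hY : Y = optSet X F h (betaTilde G F f (hG.nonempty hF)) (gammaTilde G F f (hG.nonempty hF)))
    {j : ℕ → V} (hj : ∀ t, j t ∉ F) :
    Y.Nonempty ∧ Tendsto (fun t => Metric.infDist (x t (j t)) Y) atTop (𝓝 0) := by
  subst hY
  have hN := hG.nonempty hF
  have hX : X.OrdConnected := (hh (j 0) (hj 0)).convex.1.ordConnected
  have hβ : betaTilde G F f hN ≤ 1 / (Fᶜ.card : ℝ) := min_le_right _ _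
  have hYne := optSet_nonempty hh hβ (gammaTilde_le_card (f := f) hloop hN) hN
  have hmono : ∀ i ∉ F, MonotoneOn (derivWithin (h i) X) X := fun i hi =>
    (hh i hi).convex.monotoneOn_derivWithin (hh i hi).differentiableOn
  have hV : 1 ≤ (Fintype.card V : ℝ) := Nat.one_le_cast.2 (Fintype.card_pos_iff.2 ⟨j 0⟩)
  have hV0 := zero_lt_one.trans_le hV
  exact ⟨hYne, (hx.isResilientDescent hloop hG hF hN).tendsto_infDist hX (fun _ hα => hα.1) hgrad
    hmono hlam hlim hsum hG hF (one_div_pos.2 hV0) ((div_le_one hV0).2 hV) optSet_subset hYne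
    (optSet_ordConnected hh hX hβ)
    (fun _ hc hcY => exists_pos_forall_le_dotProduct_derivWithin hh hc hcY)
    (fun _ hc hcY => exists_pos_forall_le_dotProduct_neg_derivWithin hh hc hcY) hj⟩

/-- For every choice of a non-faulty agent `j t` whose estimate has maximal distance to
`Y = Y(β̃, γ̃)` among the non-faulty agents, the distance of `z[t] = x t (j t)` to `Y` tends to
`0`; also `Y` is nonempty, so that this distance is a genuine one. -/
theorem mainTheorem2 {V : Type*} [Fintype V] [DecidableEq V]
    (G : Digraph V) (hloop : ∀ i, ¬ G.Adj i i)
    (f : ℕ) (hG : ByzantineOpt.EveryReducedGraphHasSource G f)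
    (F : Finset V) (hF : F.card ≤ f)
    (X : Set ℝ) (hXne : X.Nonempty) (hXclosed : IsClosed X) (hXconvex : Convex ℝ X)
    (L : ℝ) (h : V → ℝ → ℝ) (hh : ∀ i, ByzantineOpt.Admissible X L (h i))
    (lam : ℕ → ℝ) (hlam : ByzantineOpt.IsStepsize lam)
    (x : ℕ → V → ℝ) (hx : ByzantineOpt.IsExecution G F f X h lam x)
    (Y : Set ℝ)
    (hY : Y = ByzantineOpt.optSet X F h
      (ByzantineOpt.betaTilde G F f (hG.nonempty hF))
      (ByzantineOpt.gammaTilde G F f (hG.nonempty hF)))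
    (j : ℕ → V) (hj : ∀ t, j t ∉ F)
    (hjmax : ∀ t, ∀ i, i ∉ F → Metric.infDist (x t i) Y ≤ Metric.infDist (x t (j t)) Y) :
    Y.Nonempty ∧
    Filter.Tendsto (fun t => Metric.infDist (x t (j t)) Y) Filter.atTop (nhds 0) := by
  have hlim := hlam.tendsto_zero
  exact mainTheorem2_general hloop hG hF (fun i _ => (hh i).isConvexCost)
    (fun i _ => (hh i).bounded_grad) (hlam.antitone.le_of_tendsto hlim) hlim hlam.sum_infinite hx
    hY hj
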